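/- Let $(p_k)_{k\in\mathbb N}$ be a probability distribution with $p_k>0$ for infinitely many $k$, and let $\rho(x):=\#\{k\in\mathbb N: p_k\ge 1/x\}$ for $x>0$. Assume that for some $\beta\ge 0$, some function $\ell$ slowly varying at $\infty$, and all $\lambda>0$, $$\lim_{t\to\infty}\frac{\rho(\lambda t)-\rho(t)}{(\log t)^\beta\,\ell(\log t)}=\log\lambda ;$$ if $\beta=0$, assume in addition that $\ell$ is eventually nondecreasing and unbounded. Consider the Poissonized nested Karlin occupancy scheme generated by $(p_k)$: the boxes of generation $j$ are the words $r_1\ldots r_j\in\mathbb N^j$; each ball has an associated sequence $R_1,R_2,\ldots$ of independent random elements of $\mathbb N$ with distribution $(p_k)$, and falls into the boxes $R_1$, $R_1R_2$, $R_1R_2R_3,\ldots$ of generations $1,2,3,\ldots$; the sequences of different balls are independent, and they are independent of a Poisson process $(\pi(t))_{t\ge0}$ of unit intensity, where $\pi(t)$ is the number of balls thrown up to time $t$. Let $K^{(j)}_t$ be the number of boxes of generation $j$ hit by at least one of the first $\pi(t)$ balls. Then, for every integer $j\ge1$, the variables $K^{(j)}_t$, $t\ge 0$, have finite second moments, $$\operatorname{Var}K^{(j)}_{e^T}\sim\frac{(\log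 2)\,\Gamma(\beta+1)^j}{\Gamma(j(\beta+1))}\,T^{j\beta+j-1}\,\ell(T)^j,\qquad T\to\infty,$$ and, for all $u,v\in\mathbb R$, $$\lim_{T\to\infty}\frac{\operatorname{Cov}\big(K^{(j)}_{e^{T+u}},K^{(j)}_{e^{T+v}}\big)}{\operatorname{Var}K^{(j)}_{e^T}}=\frac{\log\big(1+e^{-|u-v|}\big)}{\log 2}.$$ -/

import Mathlib

open MeasureTheory ProbabilityTheory Filter Topology
open scoped NNReal

/-- A function `ℓ`, relevant only near `+∞`, is slowly varying at `+∞`: on some half-line it is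
measurable and positive, and `ℓ (a x) / ℓ x → 1` for every `a > 0`. -/
structure IsSlowlyVarying (ℓ : ℝ → ℝ) : Prop where
  measurable_pos : ∃ x₀ : ℝ, Measurable ((Set.Ici x₀).domRestrict ℓ) ∧ ∀ x, x₀ ≤ x → 0 < ℓ x
  tendsto_div : ∀ a : ℝ, 0 < a → Tendsto (fun x => ℓ (a * x) / ℓ x) atTop (𝓝 1)

/-- `ℓ` is eventually nondecreasing and unbounded (near `+∞`). -/
def EventuallyNondecreasingUnbounded (ℓ : ℝ → ℝ) : Prop :=
  ∃ x₀ : ℝ, MonotoneOn ℓ (Set.Ici x₀) ∧ ¬ BddAbove (ℓ '' Set.Ici x₀)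

/-- A probability distribution on a countable set of boxes (indexed by `ℕ`) with infinitely many
atoms of positive mass. -/
structure IsInfiniteDistribution (p : ℕ → ℝ) : Prop where
  nonneg : ∀ k, 0 ≤ p k
  hasSum : HasSum p 1
  infinite_pos : {k | 0 < p k}.Infinite

/-- The counting function `ρ(x) = #{k : p k ≥ 1 / x}`, for `x > 0`; the set is finite there
because `p` is summable. -/
noncomputable def countingFunction (p : ℕ → ℝ) (x : ℝ) : ℕ :=
  Set.ncard {k : ℕ | 1 / x ≤ p k}

/-- `π` is a Poisson process of unit intensity on `[0, ∞)`: it starts at `0`, its increments are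
independent, the increment over `(s, t]` has the Poisson distribution with mean `t - s`, and
almost all its paths are nondecreasing and right-continuous.
(Truncated subtraction on `ℕ` is genuine subtraction along nondecreasing paths.) -/
structure IsUnitPoissonProcess {Ω : Type*} [MeasurableSpace Ω] (π : ℝ≥0 → Ω → ℕ)
    (μ : Measure Ω) : Prop where
  measurable : ∀ t, Measurable (π t)
  zero : ∀ᵐ ω ∂μ, π 0 ω = 0
  paths : ∀ᵐ ω ∂μ, Monotone (fun t => π t ω) ∧
    ∀ t, ContinuousWithinAt (fun s => π s ω) (Set.Ici t) t
  indep_increments : HasIndepIncrements π μ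
  law_increments : ∀ s t : ℝ≥0, s ≤ t →
    HasLaw (fun ω => π t ω - π s ω) (poissonMeasure (t - s)) μ

/-- The random input of the Poissonized nested occupancy scheme generated by `p`. The number of
balls thrown up to time `t` is `π t`, for a unit Poisson process `π`. The ball with number `n`
(counted from `0`) chooses in its `i`-th step (counted from `0`) the daughter number `X n i` of
its current box; it thus visits the box `(X n 0, …, X n (j - 1))` of the `j`-th generation. All
choices of all balls are independent with distribution `p`, and they are independent of the
arrival process `π`. -/
structure IsPoissonizedNestedScheme {Ω : Type*} [MeasurableSpace Ω] (p : ℕ → ℝ)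
    (π : ℝ≥0 → Ω → ℕ) (X : ℕ → ℕ → Ω → ℕ) (μ : Measure Ω) : Prop where
  poisson : IsUnitPoissonProcess π μ
  measurable_choice : ∀ n i, Measurable (X n i)
  law_choice : ∀ n i k, μ.real {ω | X n i ω = k} = p k
  indep_choices : iIndepFun (fun (q : ℕ × ℕ) => X q.1 q.2) μ
  indep_arrivals : IndepFun (fun ω (t : ℝ≥0) => π t ω) (fun ω (q : ℕ × ℕ) => X q.1 q.2 ω) μ

/-- The set of boxes of the `j`-th generation (words of length `j`) that have been hit by one of
the first `N` balls, in the realization `ω`. -/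
def occupiedBoxes {Ω : Type*} (X : ℕ → ℕ → Ω → ℕ) (j N : ℕ) (ω : Ω) : Set (Fin j → ℕ) :=
  {r | ∃ n < N, ∀ i : Fin j, X n i ω = r i}

/-- `K_t^{(j)}`: the number of occupied boxes of the `j`-th generation when `π t` balls have been
thrown, as a real random variable. -/
noncomputable def occupiedCount {Ω : Type*} (π : ℝ≥0 → Ω → ℕ) (X : ℕ → ℕ → Ω → ℕ) (j : ℕ)
    (t : ℝ≥0) (ω : Ω) : ℝ :=
  (Set.ncard (occupiedBoxes X j (π t ω) ω) : ℝ)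

/-- The time `e^x`, as a nonnegative real number. -/
noncomputable def expTime (x : ℝ) : ℝ≥0 := ⟨Real.exp x, (Real.exp_pos x).le⟩

/-! After Poissonization distinct boxes of one generation are hit independently, so only the
diagonal contributes: for `s ≤ t` the covariance is the sum over words `r` of `exp (-p_r t) - exp
(-p_r (s + t))` (`covariance_occupiedCount`). At times `e^x ≤ e^y`, with `d = log (1 + e^{-(y -
x)})`, one has `e^x + e^y = e^{y + d}`. The sum is thus the integral of `exp (-e^{y - z}) - exp
(-e^{y + d - z})` against the point measure of the values `z = -log p_r`.

This measure is the `j`-fold convolution of the one for `j = 1`, and the hypothesis says that the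
latter has mass asymptotic to `(d - c) T^β ℓ(T)` on `(T + c, T + d]`. Such local densities convolve
(`HasLocalDensity.conv`): the new density is `T g(T) g'(T)` times a Beta integral, and the Beta
integrals telescope to the Gamma factor of the theorem (`hasLocalDensity_wordLogMeasure`).

Finally, the kernel is a smoothing of total mass `d`, concentrated near `z = y`, so the integral is
asymptotic to `d` times the density (`tendsto_lintegral_exp_neg_exp`). Equal times give `d = log 2`,
the variance; a time lag gives the other logarithm. Both limit passages use dominated convergence,
with bounds of Potter type derived from the uniform convergence theorem. -/

/-! ### Uniform convergence and Potter bounds in additive form. -/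

/-- The uniform convergence theorem for slowly varying functions, in additive form. -/
theorem eventually_abs_sub_le_of_tendsto_shift {q : ℝ → ℝ} (hq : Measurable q)
    (h : ∀ u : ℝ, Tendsto (fun x => q (x + u) - q x) atTop (𝓝 0)) {δ : ℝ} (hδ : 0 < δ) :
    ∃ Y : ℝ, ∀ x, Y ≤ x → ∀ u ∈ Set.Icc (0 : ℝ) 1, |q (x + u) - q x| ≤ δ := by
  by_contra! hcon
  choose x hx u hu hxu using fun n : ℕ => hcon n
  have hxt : Tendsto x atTop atTop := tendsto_atTop_mono hx tendsto_natCast_atTop_atTop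
  have hxut : Tendsto (fun n => x n + u n) atTop atTop :=
    tendsto_atTop_mono (fun n => le_add_of_nonneg_right (hu n).1) hxt
  -- the points at which the increments along a sequence have become small
  let V : (ℕ → ℝ) → ℕ → Set ℝ := fun z n =>
    {y | y ∈ Set.Icc (0 : ℝ) 3 ∧ ∀ m, n ≤ m → |q (z m + y) - q (z m)| ≤ δ / 2}
  have hmeas : ∀ z n, MeasurableSet (V z n) := by
    intro z n
    have : V z n = Set.Icc 0 3 ∩ ⋂ m, ⋂ (_ : n ≤ m), {y | |q (z m + y) - q (z m)| ≤ δ / 2} := by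
      ext y; simp [V]
    rw [this]
    refine measurableSet_Icc.inter (MeasurableSet.iInter fun m => MeasurableSet.iInter fun _ => ?_)
    exact measurableSet_le (by fun_prop) measurable_const
  -- The sets `V z n` increase to `[0, 3]`, so their volumes tend to 3. The threshold 5/2 works
  -- because two such sets, one of them shifted by at most 1, lie in `[0, 4]` and must meet, as 5 >
  -- 4.
  have hlarge : ∀ z : ℕ → ℝ, Tendsto z atTop atTop →
      ∀ᶠ n in atTop, ENNReal.ofReal (5 / 2) < volume (V z n) := by
    intro z hz
    have hmono : Monotone (V z) := fun a b hab y hy => ⟨hy.1, fun m hm => hy.2 m (hab.trans hm)⟩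
    have hU : ⋃ n, V z n = Set.Icc (0 : ℝ) 3 := by
      refine Set.Subset.antisymm (Set.iUnion_subset fun n y hy => hy.1) fun y hy => ?_
      have := ((h y).comp hz).abs.eventually_le_const (u := δ / 2) (by simp [hδ])
      obtain ⟨n, hn⟩ := eventually_atTop.1 this
      exact Set.mem_iUnion.2 ⟨n, hy, hn⟩
    have := tendsto_measure_iUnion_atTop (μ := volume) hmono
    rw [hU, Real.volume_Icc] at this
    exact this.eventually_const_lt ((ENNReal.ofReal_lt_ofReal_iff (by norm_num)).2 (by norm_num))
  obtain ⟨n, h1, h2⟩ := ((hlarge x hxt).and (hlarge _ hxut)).exists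
  set A := V x n
  set B := V (fun m => x m + u m) n
  have hB : volume ((fun y => y - u n) ⁻¹' B) = volume B := by
    simp [sub_eq_add_neg]
  have hBm : MeasurableSet ((fun y => y - u n) ⁻¹' B) := (measurable_sub_const _) (hmeas _ _)
  have hnd : ¬ Disjoint A ((fun y => y - u n) ⁻¹' B) := by
    intro hd
    have hsub : A ∪ (fun y => y - u n) ⁻¹' B ⊆ Set.Icc (0 : ℝ) 4 := by
      rintro y (hy | hy)
      · exact ⟨hy.1.1, hy.1.2.trans (by norm_num)⟩
      · have h3 := hy.1
        have h4 := hu n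
        simp only [Set.mem_Icc] at h3 h4 ⊢
        constructor <;> linarith
    have := measure_mono (μ := volume) hsub
    rw [measure_union hd hBm, hB, Real.volume_Icc] at this
    have h5 := (ENNReal.add_lt_add h1 h2).trans_le this
    rw [← ENNReal.ofReal_add (by norm_num) (by norm_num),
      ENNReal.ofReal_lt_ofReal_iff (by norm_num)] at h5
    norm_num at h5
  -- At a common point, `q (x n + y)` is within `δ / 2` of both `q (x n)` and `q (x n + u n)`, which
  -- are therefore too close to each other.
  obtain ⟨y, hyA, hyB⟩ := Set.not_disjoint_iff.1 hnd
  have e1 := hyA.2 n le_rfl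
  have e2 := hyB.2 n le_rfl
  have e3 := hxu n
  rw [show x n + u n + (y - u n) = x n + y by ring] at e2
  rw [abs_le] at e1 e2
  rw [lt_abs] at e3
  rcases e3 with e3 | e3 <;> linarith [e1.1, e1.2, e2.1, e2.2]

/-- Chaining steps of length at most 1 costs `δ` each; the summand 1 pays for the incomplete last
step. This is Potter's bound for `exp ∘ q`. -/
theorem exists_abs_sub_le_linear_of_tendsto_shift {q : ℝ → ℝ} (hq : Measurable q)
    (h : ∀ u : ℝ, Tendsto (fun x => q (x + u) - q x) atTop (𝓝 0)) {δ : ℝ} (hδ : 0 < δ) :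
    ∃ Y : ℝ, ∀ x, Y ≤ x → ∀ y, Y ≤ y → |q y - q x| ≤ δ * (|y - x| + 1) := by
  obtain ⟨Y, hY⟩ := eventually_abs_sub_le_of_tendsto_shift hq h hδ
  have key : ∀ n : ℕ, ∀ x, Y ≤ x → ∀ u : ℝ, 0 ≤ u → u ≤ n + 1 → |q (x + u) - q x| ≤ δ * (u + 1) := by
    intro n
    induction n with
    | zero =>
      intro x hx u hu hu1
      refine (hY x hx u ⟨hu, by simpa using hu1⟩).trans ?_
      nlinarith
    | succ n ih =>
      intro x hx u hu hu1
      rcases le_total u 1 with h1 | h1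
      · refine (hY x hx u ⟨hu, h1⟩).trans ?_
        nlinarith
      · have e1 := ih (x + 1) (by linarith) (u - 1) (by linarith) (by push_cast at hu1; linarith)
        have e2 := hY x hx 1 (by simp)
        rw [show x + 1 + (u - 1) = x + u by ring] at e1
        calc |q (x + u) - q x| ≤ |q (x + u) - q (x + 1)| + |q (x + 1) - q x| := abs_sub_le _ _ _
          _ ≤ δ * (u - 1 + 1) + δ := add_le_add e1 e2
          _ = δ * (u + 1) := by ring
  have key' : ∀ x, Y ≤ x → ∀ y, x ≤ y → |q y - q x| ≤ δ * (|y - x| + 1) := by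
    intro x hx y hxy
    obtain ⟨n, hn⟩ := exists_nat_ge (y - x)
    have := key n x hx (y - x) (by linarith) (by linarith)
    rwa [add_sub_cancel, ← abs_of_nonneg (sub_nonneg.2 hxy)] at this
  refine ⟨Y, fun x hx y hy => ?_⟩
  rcases le_total x y with hxy | hxy
  · exact key' x hx y hxy
  · rw [abs_sub_comm, abs_sub_comm y x]
    exact key' y hy x hxy

/-! ### Regularly varying functions and quasi-monotonicity. -/

/-- A measurable positive function that is regularly varying at `+∞` with index `α`. -/
structure IsRegularlyVarying (g : ℝ → ℝ) (α : ℝ) : Prop where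
  measurable : Measurable g
  pos : ∀ x, 0 < g x
  tendsto_div : ∀ a : ℝ, 0 < a → Tendsto (fun x => g (a * x) / g x) atTop (𝓝 (a ^ α))

/-- Up to a constant, `g` is eventually dominated on `(-∞, 2 T]` by its value at `T`. -/
def IsQuasiMonotone (g : ℝ → ℝ) : Prop :=
  ∃ C T₀ : ℝ, 0 < T₀ ∧ ∀ T x, T₀ ≤ T → T₀ ≤ x → x ≤ 2 * T → g x ≤ C * g T

/-- Potter's bound is applied with slope exactly `α`: for `x ≤ T` the gain `α (log x - log T)` from
the index cancels the error, and for `T ≤ x ≤ 2 T` the two add up to at most `2 α log 2`. An index 0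
would leave no gain to spend. -/
theorem IsRegularlyVarying.isQuasiMonotone {g : ℝ → ℝ} {α : ℝ} (hg : IsRegularlyVarying g α)
    (hα : 0 < α) : IsQuasiMonotone g := by
  let q : ℝ → ℝ := fun y => Real.log (g (Real.exp y)) - α * y
  have hq : Measurable q :=
    (Real.measurable_log.comp (hg.measurable.comp Real.measurable_exp)).sub
      (measurable_id.const_mul α)
  have hshift : ∀ u : ℝ, Tendsto (fun x => q (x + u) - q x) atTop (𝓝 0) := by
    intro u
    have h1 := (hg.tendsto_div (Real.exp u) (Real.exp_pos u)).comp Real.tendsto_exp_atTop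
    have h2 := (h1.log (by positivity)).sub_const (α * u)
    rw [← Real.exp_mul, Real.log_exp, mul_comm u α, sub_self] at h2
    refine h2.congr fun x => ?_
    simp only [Function.comp, q]
    rw [Real.log_div (hg.pos _).ne' (hg.pos _).ne', Real.exp_add, mul_comm (Real.exp u)]
    ring
  obtain ⟨Y, hY⟩ := exists_abs_sub_le_linear_of_tendsto_shift hq hshift hα
  refine ⟨Real.exp (2 * α * Real.log 2 + α), Real.exp Y, Real.exp_pos _, fun T x hT hx hxT => ?_⟩
  have hTpos := (Real.exp_pos Y).trans_le hT
  have hxpos := (Real.exp_pos Y).trans_le hx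
  have h1 := hY (Real.log T) ((Real.le_log_iff_exp_le hTpos).2 hT) (Real.log x)
    ((Real.le_log_iff_exp_le hxpos).2 hx)
  simp only [q, Real.exp_log hTpos, Real.exp_log hxpos] at h1
  have h2 : Real.log x ≤ Real.log 2 + Real.log T := by
    rw [← Real.log_mul two_ne_zero hTpos.ne']
    exact Real.log_le_log hxpos hxT
  have hl2 : 0 < Real.log 2 := Real.log_pos one_lt_two
  have h3 : Real.log (g x) ≤ (2 * α * Real.log 2 + α) + Real.log (g T) := by
    have h4 := (abs_le.1 h1).2
    rcases abs_cases (Real.log x - Real.log T) with ⟨h5, -⟩ | ⟨h5, -⟩ <;> rw [h5] at h4 <;> nlinarith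
  rw [← Real.exp_log (hg.pos x), ← Real.exp_log (hg.pos T), ← Real.exp_add]
  exact Real.exp_le_exp.2 h3

theorem IsRegularlyVarying.mul {f g : ℝ → ℝ} {a b : ℝ} (hf : IsRegularlyVarying f a)
    (hg : IsRegularlyVarying g b) : IsRegularlyVarying (fun x => f x * g x) (a + b) where
  measurable := hf.measurable.mul hg.measurable
  pos x := mul_pos (hf.pos x) (hg.pos x)
  tendsto_div c hc := by
    rw [Real.rpow_add hc]
    refine ((hf.tendsto_div c hc).mul (hg.tendsto_div c hc)).congr fun x => ?_
    rw [mul_div_mul_comm]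

theorem IsRegularlyVarying.const_mul {f : ℝ → ℝ} {a c : ℝ} (hf : IsRegularlyVarying f a)
    (hc : 0 < c) : IsRegularlyVarying (fun x => c * f x) a where
  measurable := hf.measurable.const_mul c
  pos x := mul_pos hc (hf.pos x)
  tendsto_div d hd := by
    refine (hf.tendsto_div d hd).congr fun x => ?_
    rw [mul_div_mul_left _ _ hc.ne']

theorem isRegularlyVarying_max_one_rpow (a : ℝ) :
    IsRegularlyVarying (fun x => (max x 1) ^ a) a where
  measurable := by fun_prop
  pos x := by positivity
  tendsto_div c hc := by
    refine tendsto_const_nhds.congr' ?_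
    filter_upwards [eventually_ge_atTop 1, eventually_ge_atTop (1 / c)] with x hx hxc
    have : 1 ≤ c * x := by rwa [div_le_iff₀' hc] at hxc
    rw [max_eq_left hx, max_eq_left this, Real.mul_rpow hc.le (by linarith), mul_div_cancel_right₀]
    positivity

/-! ### Measures with a local density at infinity, and their convolution. -/

/-- The measure `ν` lives on `[0, ∞)`, is finite on half-lines `(-∞, T]`, and near `+∞` it looks
locally like Lebesgue measure with density `g`. -/
structure HasLocalDensity (ν : Measure ℝ) (g : ℝ → ℝ) : Prop where
  null_neg : ν (Set.Iio 0) = 0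
  lt_top : ∀ T, ν (Set.Iic T) < ⊤
  tendsto : ∀ c d : ℝ, c < d →
    Tendsto (fun T => ν.real (Set.Ioc (T + c) (T + d)) / g T) atTop (𝓝 (d - c))

namespace HasLocalDensity

variable {ν ν' : Measure ℝ} {g g' : ℝ → ℝ} {α α' : ℝ}

theorem Ioc_lt_top (h : HasLocalDensity ν g) (a b : ℝ) : ν (Set.Ioc a b) < ⊤ :=
  (measure_mono Set.Ioc_subset_Iic_self).trans_lt (h.lt_top b)

theorem real_Ioc_le (h : HasLocalDensity ν g) {a b b' : ℝ} (hb : b ≤ b') :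
    ν.real (Set.Ioc a b) ≤ ν.real (Set.Iic b') :=
  measureReal_mono (Set.Ioc_subset_Iic_self.trans (Set.Iic_subset_Iic.2 hb)) (h.lt_top _).ne

theorem real_Ioc_eq_zero (h : HasLocalDensity ν g) {a b : ℝ} (hb : b < 0) :
    ν.real (Set.Ioc a b) = 0 := by
  rw [measureReal_def, measure_mono_null (fun x hx => hx.2.trans_lt hb) h.null_neg]
  rfl

theorem real_Ioc_eq_sub (h : HasLocalDensity ν g) {a b : ℝ} (hab : a ≤ b) :
    ν.real (Set.Ioc a b) = ν.real (Set.Iic b) - ν.real (Set.Iic a) := by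
  rw [← Set.Iic_sdiff_Iic, measureReal_sdiff (Set.Iic_subset_Iic.2 hab) measurableSet_Iic
    (h.lt_top b).ne]

theorem measurable_real_Ioc (h : HasLocalDensity ν g) (c d : ℝ) :
    Measurable fun x => ν.real (Set.Ioc (x + c) (x + d)) := by
  rcases le_total c d with hcd | hcd
  · have hm : Monotone fun x => ν.real (Set.Iic x) := fun x y hxy =>
      measureReal_mono (Set.Iic_subset_Iic.2 hxy) (h.lt_top _).ne
    simp_rw [fun x => h.real_Ioc_eq_sub (add_le_add_right hcd x)]
    exact (hm.measurable.comp (measurable_add_const d)).sub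
      (hm.measurable.comp (measurable_add_const c))
  · simp [hcd]

theorem measurable_Ioc (h : HasLocalDensity ν g) (c d : ℝ) :
    Measurable fun x => ν (Set.Ioc (x + c) (x + d)) := by
  have := (h.measurable_real_Ioc c d).ennreal_ofReal
  simp_rw [fun x => ofReal_measureReal (h.Ioc_lt_top (x + c) (x + d)).ne] at this
  exact this

/-- Far out, the local density and quasi-monotonicity give the bound. Below the threshold `T₀` the
mass is at most a constant, and quasi-monotonicity bounds `g T₀` by a multiple of `g T`. -/
theorem exists_le_mul (h : HasLocalDensity ν g) (hpos : ∀ x, 0 < g x) (hq : IsQuasiMonotone g)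
    {c d : ℝ} (hcd : c < d) : ∃ C T₀ : ℝ, ∀ T x, T₀ ≤ T → x ≤ 2 * T →
      ν.real (Set.Ioc (x + c) (x + d)) ≤ C * g T := by
  obtain ⟨C, T₁, hT₁, hC⟩ := hq
  have hev := (h.tendsto c d hcd).eventually_le_const (lt_add_one _)
  obtain ⟨X, hX⟩ := eventually_atTop.1 hev
  set T₀ := max T₁ X
  have hT₀ : T₁ ≤ T₀ := le_max_left _ _
  have hCpos : 0 < C := by
    have := hC T₀ T₀ hT₀ hT₀ (by linarith)
    by_contra! hneg
    nlinarith [hpos T₀]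
  set K := ν.real (Set.Iic (T₀ + d))
  have hK : 0 ≤ K := measureReal_nonneg
  refine ⟨((d - c + 1) + K / g T₀) * C, T₀, fun T x hT hx => ?_⟩
  have hKg : 0 ≤ K / g T₀ := div_nonneg hK (hpos _).le
  rcases le_total T₀ x with hx0 | hx0
  · have h1 := hX x ((le_max_right _ _).trans hx0)
    rw [div_le_iff₀ (hpos x)] at h1
    have h2 := hC T x (hT₀.trans hT) (hT₀.trans hx0) hx
    calc _ ≤ (d - c + 1) * g x := h1
      _ ≤ (d - c + 1) * (C * g T) := by gcongr
      _ ≤ _ := by nlinarith [mul_nonneg hKg (mul_pos hCpos (hpos T)).le]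
  · have h1 : ν.real (Set.Ioc (x + c) (x + d)) ≤ K := h.real_Ioc_le (by linarith)
    have h2 := hC T T₀ (hT₀.trans hT) hT₀ (by linarith)
    have h3 : K ≤ K / g T₀ * (C * g T) := by
      calc K = K / g T₀ * g T₀ := by rw [div_mul_cancel₀ _ (hpos T₀).ne']
        _ ≤ _ := by gcongr
    refine h1.trans (h3.trans ?_)
    have : 0 ≤ (d - c + 1) * (C * g T) :=
      mul_nonneg (by linarith) (mul_pos hCpos (hpos T)).le
    nlinarith

/-- The dominating function for the convolution. Since both measures vanish on the negative axis,
the product is zero once `z` is outside `[-T, 2T]`, for `T` large. -/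
theorem cell_mul_le (h : HasLocalDensity ν g) (h' : HasLocalDensity ν' g')
    (hpos : ∀ x, 0 < g x) (hpos' : ∀ x, 0 < g' x) (hq : IsQuasiMonotone g)
    (hq' : IsQuasiMonotone g') {ε a b : ℝ} (hε : 0 < ε) (hab : a < b) :
    ∃ C T₀ : ℝ, ∀ T, T₀ ≤ T → ∀ z,
      ν.real (Set.Ioc (z + 0) (z + ε)) * ν'.real (Set.Ioc (T - z + a) (T - z + b)) ≤
        (Set.Icc (-T) (2 * T)).indicator (fun _ => C * (g T * g' T)) z := by
  obtain ⟨C, T₁, hC⟩ := h.exists_le_mul hpos hq hε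
  obtain ⟨C', T₁', hC'⟩ := h'.exists_le_mul hpos' hq' hab
  refine ⟨C * C', max (max T₁ T₁') (max (ε + 1) (|b| + 1)), fun T hT z => ?_⟩
  simp only [max_le_iff] at hT
  obtain ⟨⟨hT1, hT2⟩, hT3, hT4⟩ := hT
  by_cases hz : z ∈ Set.Icc (-T) (2 * T)
  · rw [Set.indicator_of_mem hz]
    have h1 := hC T z hT1 hz.2
    have h2 := hC' T (T - z) hT2 (by linarith [hz.1])
    calc _ ≤ (C * g T) * (C' * g' T) :=
          mul_le_mul h1 h2 measureReal_nonneg (measureReal_nonneg.trans h1)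
      _ = _ := by ring
  · rw [Set.indicator_of_notMem hz]
    rw [Set.mem_Icc, not_and_or, not_le, not_le] at hz
    rcases hz with hz | hz
    · rw [h.real_Ioc_eq_zero (by linarith), zero_mul]
    · rw [h'.real_Ioc_eq_zero (by linarith [le_abs_self b]), mul_zero]

theorem integrable_cell_mul (h : HasLocalDensity ν g) (h' : HasLocalDensity ν' g')
    (hpos : ∀ x, 0 < g x) (hpos' : ∀ x, 0 < g' x) (hq : IsQuasiMonotone g)
    (hq' : IsQuasiMonotone g') {ε a b : ℝ} (hε : 0 < ε) (hab : a < b) :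
    ∀ᶠ T in atTop, Integrable fun z =>
      ν.real (Set.Ioc (z + 0) (z + ε)) * ν'.real (Set.Ioc (T - z + a) (T - z + b)) := by
  obtain ⟨C, T₀, hC⟩ := h.cell_mul_le h' hpos hpos' hq hq' hε hab
  filter_upwards [eventually_ge_atTop T₀] with T hT
  refine Integrable.mono' (g := (Set.Icc (-T) (2 * T)).indicator (fun _ => C * (g T * g' T)))
    ?_ ?_ (ae_of_all _ fun z => ?_)
  · exact (integrable_indicator_iff measurableSet_Icc).2 (integrableOn_const (by simp))
  · exact ((h.measurable_real_Ioc 0 ε).mul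
      ((h'.measurable_real_Ioc a b).comp (measurable_const.sub measurable_id))).aestronglyMeasurable
  · rw [Real.norm_of_nonneg (mul_nonneg measureReal_nonneg measureReal_nonneg)]
    exact hC T hT z

/-- Substitute `z = T s`. Regular variation turns `g (s T) / g T` and `g' ((1 - s) T) / g' T` into
the Beta integrand on `(0, 1)`; for `s` outside `[0, 1]` the integrand is eventually zero. -/
theorem tendsto_integral_cell_mul (h : HasLocalDensity ν g) (h' : HasLocalDensity ν' g')
    (hg : IsRegularlyVarying g α) (hg' : IsRegularlyVarying g' α') (hq : IsQuasiMonotone g)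
    (hq' : IsQuasiMonotone g') {ε a b : ℝ} (hε : 0 < ε) (hab : a < b) :
    Tendsto (fun T => (∫ z, ν.real (Set.Ioc (z + 0) (z + ε)) *
        ν'.real (Set.Ioc (T - z + a) (T - z + b))) / (T * (g T * g' T))) atTop
      (𝓝 (ε * (b - a) * ∫ s in Set.Ioo (0 : ℝ) 1, s ^ α * (1 - s) ^ α')) := by
  have hpos := hg.pos
  have hpos' := hg'.pos
  obtain ⟨C, T₀, hC⟩ := h.cell_mul_le h' hpos hpos' hq hq' hε hab
  have hlim : Tendsto (fun T => ∫ s, (ν.real (Set.Ioc (T * s + 0) (T * s + ε)) *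
        ν'.real (Set.Ioc (T - T * s + a) (T - T * s + b))) / (g T * g' T)) atTop
      (𝓝 (∫ s, (Set.Ioo (0 : ℝ) 1).indicator
        (fun s => ε * (b - a) * (s ^ α * (1 - s) ^ α')) s)) := by
    refine tendsto_integral_filter_of_dominated_convergence
      ((Set.Icc (-1 : ℝ) 2).indicator fun _ => C) ?_ ?_ ?_ ?_
    · refine Eventually.of_forall fun T => Measurable.aestronglyMeasurable ?_
      refine Measurable.div_const ?_ _
      exact ((h.measurable_real_Ioc 0 ε).comp (measurable_id.const_mul T)).mul
        ((h'.measurable_real_Ioc a b).comp (measurable_const.sub (measurable_id.const_mul T)))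
    · filter_upwards [eventually_ge_atTop T₀, eventually_gt_atTop 0] with T hT hT0
      refine ae_of_all _ fun s => ?_
      have hgg := mul_pos (hpos T) (hpos' T)
      rw [Real.norm_of_nonneg (div_nonneg (mul_nonneg measureReal_nonneg measureReal_nonneg)
        hgg.le), div_le_iff₀ hgg]
      refine (hC T hT (T * s)).trans (le_of_eq ?_)
      by_cases hs : s ∈ Set.Icc (-1 : ℝ) 2
      · rw [Set.indicator_of_mem hs, Set.indicator_of_mem]
        exact ⟨by nlinarith [hs.1], by nlinarith [hs.2]⟩
      · rw [Set.indicator_of_notMem hs, Set.indicator_of_notMem, zero_mul]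
        intro hs'
        exact hs ⟨by nlinarith [hs'.1], by nlinarith [hs'.2]⟩
    · exact (integrable_indicator_iff measurableSet_Icc).2 (integrableOn_const (by simp))
    · have h0 : ∀ᵐ s : ℝ, s ≠ 0 := by simp [ae_iff]
      have h1 : ∀ᵐ s : ℝ, s ≠ 1 := by simp [ae_iff]
      filter_upwards [h0, h1] with s hs0 hs1
      by_cases hs : s ∈ Set.Ioo (0 : ℝ) 1
      · rw [Set.indicator_of_mem hs]
        have hs' : 0 < 1 - s := sub_pos.2 hs.2
        have e1 : Tendsto (fun T : ℝ => s * T) atTop atTop := tendsto_id.const_mul_atTop hs.1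
        have e2 : Tendsto (fun T : ℝ => (1 - s) * T) atTop atTop := tendsto_id.const_mul_atTop hs'
        have l1 := ((h.tendsto 0 ε hε).comp e1).mul (hg.tendsto_div s hs.1)
        have l2 := ((h'.tendsto a b hab).comp e2).mul (hg'.tendsto_div _ hs')
        have := l1.mul l2
        rw [sub_zero] at this
        convert this using 2 with T
        · simp only [Function.comp]
          rw [div_mul_div_cancel₀ (hpos _).ne', div_mul_div_cancel₀ (hpos' _).ne',
            div_mul_div_comm, mul_comm s T, show (1 - s) * T = T - T * s by ring]
        · ring
      · rw [Set.indicator_of_notMem hs]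
        refine tendsto_const_nhds.congr' ?_
        rcases lt_or_gt_of_ne hs0 with hs2 | hs2
        · filter_upwards [(tendsto_id.const_mul_atTop_of_neg hs2).eventually_lt_atBot (-ε)]
            with T hT
          simp only [id] at hT
          rw [h.real_Ioc_eq_zero (by linarith), zero_mul, zero_div]
        · have hs3 : 1 - s < 0 := by
            rcases lt_or_gt_of_ne hs1 with hs4 | hs4
            · exact absurd ⟨hs2, hs4⟩ hs
            · linarith
          filter_upwards [(tendsto_id.const_mul_atTop_of_neg hs3).eventually_lt_atBot (-b)]
            with T hT
          simp only [id] at hT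
          rw [h'.real_Ioc_eq_zero (by linarith), mul_zero, zero_div]
  rw [integral_indicator measurableSet_Ioo, integral_const_mul] at hlim
  refine hlim.congr' ?_
  filter_upwards [eventually_gt_atTop 0] with T hT
  rw [integral_div, Measure.integral_comp_mul_left (fun z => ν.real (Set.Ioc (z + 0) (z + ε)) *
        ν'.real (Set.Ioc (T - z + a) (T - z + b))) T, abs_of_pos (inv_pos.2 hT), smul_eq_mul]
  have := (hpos T).ne'
  have := (hpos' T).ne'
  field_simp

theorem conv_Iio_zero [SFinite ν] [SFinite ν'] (h : HasLocalDensity ν g)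
    (h' : HasLocalDensity ν' g') : (ν ∗ ν') (Set.Iio 0) = 0 := by
  rw [Measure.conv, Measure.map_apply (by fun_prop) measurableSet_Iio]
  refine measure_mono_null (t := Set.Iio 0 ×ˢ Set.univ ∪ Set.univ ×ˢ Set.Iio 0) ?_ ?_
  · rintro ⟨x, y⟩ hxy
    simp only [Set.mem_preimage, Set.mem_Iio, Set.mem_union, Set.mem_prod, Set.mem_univ, and_true,
      true_and] at hxy ⊢
    by_contra! hcon
    linarith
  · rw [measure_union_null_iff, Measure.prod_prod, Measure.prod_prod, h.null_neg, h'.null_neg]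
    simp

theorem conv_Iic_lt_top [SFinite ν] [SFinite ν'] (h : HasLocalDensity ν g)
    (h' : HasLocalDensity ν' g') (T : ℝ) : (ν ∗ ν') (Set.Iic T) < ⊤ := by
  rw [Measure.conv, Measure.map_apply (by fun_prop) measurableSet_Iic]
  have : (fun x : ℝ × ℝ => x.1 + x.2) ⁻¹' Set.Iic T ⊆
      (Set.Iio 0 ×ˢ Set.univ ∪ Set.univ ×ˢ Set.Iio 0) ∪ Set.Iic T ×ˢ Set.Iic T := by
    rintro ⟨x, y⟩ hxy
    simp only [Set.mem_preimage, Set.mem_Iic, Set.mem_Iio, Set.mem_union, Set.mem_prod,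
      Set.mem_univ, and_true, true_and] at hxy ⊢
    by_contra! hcon
    by_cases hx : x ≤ T
    · linarith [hcon.2 hx]
    · linarith [hcon.1.2]
  refine (measure_mono this).trans_lt ?_
  refine (measure_union_le _ _).trans_lt (ENNReal.add_lt_top.2 ⟨?_, ?_⟩)
  · have : (ν.prod ν') (Set.Iio 0 ×ˢ Set.univ ∪ Set.univ ×ˢ Set.Iio 0) = 0 := by
      rw [measure_union_null_iff, Measure.prod_prod, Measure.prod_prod, h.null_neg, h'.null_neg]
      simp
    simp [this]
  · rw [Measure.prod_prod]
    exact ENNReal.mul_lt_top (h.lt_top T) (h'.lt_top T)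

theorem conv_Ioc_eq [SFinite ν] [SFinite ν'] (c d : ℝ) :
    (ν ∗ ν') (Set.Ioc c d) = ∫⁻ y, ν' (Set.Ioc (-y + c) (-y + d)) ∂ν := by
  rw [← lintegral_indicator_one measurableSet_Ioc,
    Measure.lintegral_conv (measurable_one.indicator measurableSet_Ioc)]
  congr 1 with y
  rw [← lintegral_indicator_one measurableSet_Ioc]
  congr 1 with x
  refine Set.indicator_eq_indicator ?_ rfl
  simp only [Set.mem_Ioc]
  constructor <;> rintro ⟨h1, h2⟩ <;> constructor <;> linarith

/-- A continuous substitute for cutting the line into cells: each `y` lies in `(z, z + ε]` for a set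
of `z` of length `ε`. -/
theorem ofReal_mul_conv_Ioc [SFinite ν] [SFinite ν'] (h' : HasLocalDensity ν' g') (c d ε : ℝ) :
    ENNReal.ofReal ε * (ν ∗ ν') (Set.Ioc c d) =
      ∫⁻ z, ∫⁻ y in Set.Ioc z (z + ε), ν' (Set.Ioc (-y + c) (-y + d)) ∂ν := by
  have hm : Measurable fun y => ν' (Set.Ioc (-y + c) (-y + d)) :=
    (h'.measurable_Ioc c d).comp measurable_neg
  have hS : MeasurableSet {x : ℝ × ℝ | x.2 < x.1 ∧ x.1 ≤ x.2 + ε} :=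
    (measurableSet_lt measurable_snd measurable_fst).inter
      (measurableSet_le measurable_fst (measurable_snd.add_const ε))
  have hmm : Measurable (Function.uncurry fun y z : ℝ =>
      (Set.Ioc z (z + ε)).indicator (fun y => ν' (Set.Ioc (-y + c) (-y + d))) y) := by
    have : (Function.uncurry fun y z : ℝ =>
      (Set.Ioc z (z + ε)).indicator (fun y => ν' (Set.Ioc (-y + c) (-y + d))) y) =
      {x : ℝ × ℝ | x.2 < x.1 ∧ x.1 ≤ x.2 + ε}.indicator
        (fun x => ν' (Set.Ioc (-x.1 + c) (-x.1 + d))) := by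
      ext ⟨y, z⟩
      simp only [Function.uncurry_apply_pair, Set.indicator, Set.mem_Ioc, Set.mem_ofPred_eq]
    rw [this]
    exact (hm.comp measurable_fst).indicator hS
  simp_rw [← lintegral_indicator measurableSet_Ioc]
  rw [← lintegral_lintegral_swap hmm.aemeasurable, conv_Ioc_eq,
    ← lintegral_const_mul _ hm]
  congr 1 with y
  have : ∀ z, (Set.Ioc z (z + ε)).indicator (fun y => ν' (Set.Ioc (-y + c) (-y + d))) y =
      (Set.Ico (y - ε) y).indicator (fun _ => ν' (Set.Ioc (-y + c) (-y + d))) z := by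
    intro z
    by_cases hz : z ∈ Set.Ico (y - ε) y
    · rw [Set.indicator_of_mem hz, Set.indicator_of_mem]
      exact ⟨hz.2, by linarith [hz.1]⟩
    · rw [Set.indicator_of_notMem hz, Set.indicator_of_notMem]
      exact fun hy => hz ⟨by linarith [hy.2], hy.1⟩
  simp_rw [this]
  rw [lintegral_indicator measurableSet_Ico, setLIntegral_const, Real.volume_Ico,
    sub_sub_cancel, mul_comm]

theorem lintegral_cell_mul_eq (h : HasLocalDensity ν g) (h' : HasLocalDensity ν' g')
    {T ε a b : ℝ} (hi : Integrable fun z => ν.real (Set.Ioc (z + 0) (z + ε)) *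
      ν'.real (Set.Ioc (T - z + a) (T - z + b))) :
    ∫⁻ z, ν' (Set.Ioc (T - z + a) (T - z + b)) * ν (Set.Ioc z (z + ε)) =
      ENNReal.ofReal (∫ z, ν.real (Set.Ioc (z + 0) (z + ε)) *
        ν'.real (Set.Ioc (T - z + a) (T - z + b))) := by
  rw [ofReal_integral_eq_lintegral_ofReal hi
    (ae_of_all _ fun z => mul_nonneg measureReal_nonneg measureReal_nonneg)]
  congr 1 with z
  rw [ENNReal.ofReal_mul measureReal_nonneg, ofReal_measureReal (h.Ioc_lt_top _ _).ne,
    ofReal_measureReal (h'.Ioc_lt_top _ _).ne, add_zero, mul_comm]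

/-- For `y` in `(z, z + ε]`, replacing `y` by `z` is paid for by lowering the left endpoint by `ε`.
The companion lower bound lowers the right endpoint instead. -/
theorem mul_conv_real_Ioc_le [SFinite ν] [SFinite ν'] (h : HasLocalDensity ν g)
    (h' : HasLocalDensity ν' g') {T ε c d : ℝ} (hε : 0 < ε)
    (hi : Integrable fun z => ν.real (Set.Ioc (z + 0) (z + ε)) *
      ν'.real (Set.Ioc (T - z + (c - ε)) (T - z + d))) :
    ε * (ν ∗ ν').real (Set.Ioc (T + c) (T + d)) ≤ ∫ z, ν.real (Set.Ioc (z + 0) (z + ε)) *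
      ν'.real (Set.Ioc (T - z + (c - ε)) (T - z + d)) := by
  have key : ENNReal.ofReal ε * (ν ∗ ν') (Set.Ioc (T + c) (T + d)) ≤
      ENNReal.ofReal (∫ z, ν.real (Set.Ioc (z + 0) (z + ε)) *
        ν'.real (Set.Ioc (T - z + (c - ε)) (T - z + d))) := by
    rw [← h.lintegral_cell_mul_eq h' hi, ofReal_mul_conv_Ioc h']
    refine lintegral_mono fun z => ?_
    rw [← setLIntegral_const]
    refine setLIntegral_mono measurable_const fun y hy => measure_mono (Set.Ioc_subset_Ioc ?_ ?_)
    · linarith [hy.2]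
    · linarith [hy.1]
  have hnn : 0 ≤ ∫ z, ν.real (Set.Ioc (z + 0) (z + ε)) *
        ν'.real (Set.Ioc (T - z + (c - ε)) (T - z + d)) :=
    integral_nonneg fun z => mul_nonneg measureReal_nonneg measureReal_nonneg
  have := ENNReal.toReal_mono ENNReal.ofReal_ne_top key
  rwa [ENNReal.toReal_mul, ENNReal.toReal_ofReal hε.le, ENNReal.toReal_ofReal hnn] at this

theorem le_mul_conv_real_Ioc [SFinite ν] [SFinite ν'] (h : HasLocalDensity ν g)
    (h' : HasLocalDensity ν' g') {T ε c d : ℝ} (hε : 0 < ε)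
    (hi : Integrable fun z => ν.real (Set.Ioc (z + 0) (z + ε)) *
      ν'.real (Set.Ioc (T - z + c) (T - z + (d - ε)))) :
    ∫ z, ν.real (Set.Ioc (z + 0) (z + ε)) *
      ν'.real (Set.Ioc (T - z + c) (T - z + (d - ε))) ≤
        ε * (ν ∗ ν').real (Set.Ioc (T + c) (T + d)) := by
  have key : ENNReal.ofReal (∫ z, ν.real (Set.Ioc (z + 0) (z + ε)) *
        ν'.real (Set.Ioc (T - z + c) (T - z + (d - ε)))) ≤
      ENNReal.ofReal ε * (ν ∗ ν') (Set.Ioc (T + c) (T + d)) := by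
    rw [← h.lintegral_cell_mul_eq h' hi, ofReal_mul_conv_Ioc h']
    refine lintegral_mono fun z => ?_
    rw [← setLIntegral_const]
    refine setLIntegral_mono ((h'.measurable_Ioc _ _).comp measurable_neg)
      fun y hy => measure_mono (Set.Ioc_subset_Ioc ?_ ?_)
    · linarith [hy.1]
    · linarith [hy.2]
  have hnn : 0 ≤ ∫ z, ν.real (Set.Ioc (z + 0) (z + ε)) *
        ν'.real (Set.Ioc (T - z + c) (T - z + (d - ε))) :=
    integral_nonneg fun z => mul_nonneg measureReal_nonneg measureReal_nonneg
  have hfin : (ν ∗ ν') (Set.Ioc (T + c) (T + d)) ≠ ⊤ :=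
    ((measure_mono Set.Ioc_subset_Iic_self).trans_lt (h.conv_Iic_lt_top h' _)).ne
  have := ENNReal.toReal_mono (ENNReal.mul_ne_top ENNReal.ofReal_ne_top hfin) key
  rwa [ENNReal.toReal_mul, ENNReal.toReal_ofReal hε.le, ENNReal.toReal_ofReal hnn] at this

/-- The cell bounds squeeze the quotient between limits `(d - c ∓ ε)` times the Beta integral, after
division by `ε`; then `ε` is taken small. -/
theorem tendsto_conv [SFinite ν] [SFinite ν'] (h : HasLocalDensity ν g)
    (h' : HasLocalDensity ν' g') (hg : IsRegularlyVarying g α) (hg' : IsRegularlyVarying g' α')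
    (hq : IsQuasiMonotone g) (hq' : IsQuasiMonotone g') {c d : ℝ} (hcd : c < d) :
    Tendsto (fun T => (ν ∗ ν').real (Set.Ioc (T + c) (T + d)) / (T * (g T * g' T))) atTop
      (𝓝 ((d - c) * ∫ s in Set.Ioo (0 : ℝ) 1, s ^ α * (1 - s) ^ α')) := by
  set B := ∫ s in Set.Ioo (0 : ℝ) 1, s ^ α * (1 - s) ^ α'
  have hlin : ∀ k : ℝ, Tendsto (fun ε : ℝ => (d - c + k * ε) * B) (𝓝[>] 0) (𝓝 ((d - c) * B)) := by
    intro k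
    have : Continuous fun ε : ℝ => (d - c + k * ε) * B := by fun_prop
    have h2 := this.tendsto 0
    simp only [mul_zero, add_zero] at h2
    exact h2.mono_left nhdsWithin_le_nhds
  refine tendsto_order.2 ⟨fun x hx => ?_, fun x hx => ?_⟩
  · obtain ⟨ε, hε1, hε2, hε⟩ := (((hlin (-1)).eventually_const_lt hx).and
      ((eventually_lt_nhds (sub_pos.2 hcd)).filter_mono nhdsWithin_le_nhds |>.and
        self_mem_nhdsWithin)).exists
    have hε : 0 < ε := hε
    have hcd' : c < d - ε := by linarith
    have hl := (h.tendsto_integral_cell_mul h' hg hg' hq hq' hε hcd').eventually_const_lt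
      (u := ε * x) (by
        rw [mul_assoc]
        refine mul_lt_mul_of_pos_left ?_ hε
        convert hε1 using 2
        ring)
    filter_upwards [hl, h.integrable_cell_mul h' hg.pos hg'.pos hq hq' hε hcd',
      eventually_gt_atTop 0] with T hT hi hT0
    have hD := mul_pos hT0 (mul_pos (hg.pos T) (hg'.pos T))
    rw [lt_div_iff₀ hD] at hT ⊢
    have := h.le_mul_conv_real_Ioc h' hε hi
    rw [mul_assoc] at hT
    exact lt_of_mul_lt_mul_left (hT.trans_le this) hε.le
  · obtain ⟨ε, hε1, hε⟩ := (((hlin 1).eventually_lt_const hx).and self_mem_nhdsWithin).exists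
    have hε : 0 < ε := hε
    have hcd' : c - ε < d := by linarith
    have hl := (h.tendsto_integral_cell_mul h' hg hg' hq hq' hε hcd').eventually_lt_const
      (u := ε * x) (by
        rw [mul_assoc]
        refine mul_lt_mul_of_pos_left ?_ hε
        convert hε1 using 2
        ring)
    filter_upwards [hl, h.integrable_cell_mul h' hg.pos hg'.pos hq hq' hε hcd',
      eventually_gt_atTop 0] with T hT hi hT0
    have hD := mul_pos hT0 (mul_pos (hg.pos T) (hg'.pos T))
    rw [div_lt_iff₀ hD] at hT ⊢
    have := h.mul_conv_real_Ioc_le h' hε hi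
    rw [mul_assoc] at hT
    exact lt_of_mul_lt_mul_left (this.trans_lt hT) hε.le

theorem conv [SFinite ν] [SFinite ν'] (h : HasLocalDensity ν g)
    (h' : HasLocalDensity ν' g') (hg : IsRegularlyVarying g α) (hg' : IsRegularlyVarying g' α')
    (hq : IsQuasiMonotone g) (hq' : IsQuasiMonotone g') {f : ℝ → ℝ} {B : ℝ} (hB : B ≠ 0)
    (hBeq : ∫ s in Set.Ioo (0 : ℝ) 1, s ^ α * (1 - s) ^ α' = B)
    (hf : ∀ᶠ T in atTop, f T = B * (T * (g T * g' T))) : HasLocalDensity (ν ∗ ν') f where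
  null_neg := h.conv_Iio_zero h'
  lt_top := h.conv_Iic_lt_top h'
  tendsto c d hcd := by
    have := (h.tendsto_conv h' hg hg' hq hq' hcd).div_const B
    rw [hBeq, mul_div_cancel_right₀ _ hB] at this
    refine this.congr' ?_
    filter_upwards [hf] with T hT
    rw [hT, div_div, mul_comm B]

end HasLocalDensity

/-! ### Smoothing by the double exponential kernel. -/

namespace HasLocalDensity

variable {ν : Measure ℝ} {g : ℝ → ℝ}

/-- The mass of `(T + u, T + u + 1]` is asymptotic both to `g T` and to `g (T + u)`. -/
theorem tendsto_shift_div (h : HasLocalDensity ν g) (hpos : ∀ x, 0 < g x) (u : ℝ) :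
    Tendsto (fun T => g (T + u) / g T) atTop (𝓝 1) := by
  have h1 := h.tendsto u (u + 1) (by linarith)
  have h2 := (h.tendsto 0 1 one_pos).comp (tendsto_atTop_add_const_right atTop u tendsto_id)
  have h3 := h1.div h2 (by norm_num)
  simp only [add_sub_cancel_left, sub_zero, div_one] at h3
  have h4 := h2.eventually_ne (by norm_num : (1 : ℝ) - 0 ≠ 0)
  refine h3.congr' ?_
  filter_upwards [h4] with T hT
  simp only [Function.comp, id, add_zero, Pi.div_apply, add_assoc] at hT ⊢
  have hT' := (div_ne_zero_iff.1 hT).1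
  have := (hpos T).ne'
  have := (hpos (T + u)).ne'
  field_simp

/-- Potter's bound for `log g` with slope 1/2. At `x = T - log w` the exponential becomes the larger
of `w^{1/2}` and `w^{-1/2}`, which is integrable against `e^{-w}` on `(0, ∞)`; a slope below 1 is
what integrability at 0 requires. -/
theorem exists_le_mul_exp (h : HasLocalDensity ν g) (hm : Measurable g) (hpos : ∀ x, 0 < g x)
    {d : ℝ} (hd : 0 < d) : ∃ C T₀ : ℝ, ∀ T, T₀ ≤ T → ∀ x,
      ν.real (Set.Ioc (x + 0) (x + d)) ≤ C * Real.exp (|x - T| / 2) * g T := by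
  obtain ⟨Y, hY⟩ := exists_abs_sub_le_linear_of_tendsto_shift
    (q := fun x => Real.log (g x)) (Real.measurable_log.comp hm) (fun u => by
      have := (h.tendsto_shift_div hpos u).log one_ne_zero
      rw [Real.log_one] at this
      exact this.congr fun x => Real.log_div (hpos _).ne' (hpos _).ne') (δ := 1 / 2) (by norm_num)
  have hpot : ∀ x, Y ≤ x → ∀ y, Y ≤ y →
      g y ≤ Real.exp (1 / 2) * Real.exp (|y - x| / 2) * g x := by
    intro x hx y hy
    have := (abs_le.1 (hY x hx y hy)).2
    rw [← Real.exp_log (hpos x), ← Real.exp_log (hpos y), ← Real.exp_add, ← Real.exp_add]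
    exact Real.exp_le_exp.2 (by linarith)
  obtain ⟨X, hX⟩ := eventually_atTop.1
    ((h.tendsto 0 d hd).eventually_le_const (lt_add_one _))
  set T₀ := max X Y
  set K := ν.real (Set.Iic (T₀ + d))
  have hK : 0 ≤ K := measureReal_nonneg
  have hKg : 0 ≤ K / g T₀ := div_nonneg hK (hpos _).le
  refine ⟨(d + 1 + K / g T₀) * Real.exp (1 / 2), T₀, fun T hT x => ?_⟩
  have hYT : Y ≤ T := (le_max_right _ _).trans hT
  have hE : 0 ≤ Real.exp (1 / 2) * Real.exp (|x - T| / 2) * g T := by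
    have := hpos T
    positivity
  rcases le_total T₀ x with hx | hx
  · have h1 := hX x ((le_max_left _ _).trans hx)
    rw [div_le_iff₀ (hpos x), sub_zero] at h1
    have h2 := hpot T hYT x ((le_max_right _ _).trans hx)
    calc _ ≤ (d + 1) * g x := h1
      _ ≤ (d + 1) * (Real.exp (1 / 2) * Real.exp (|x - T| / 2) * g T) := by gcongr
      _ ≤ _ := by nlinarith [mul_nonneg hKg hE]
  · have h1 : ν.real (Set.Ioc (x + 0) (x + d)) ≤ K := h.real_Ioc_le (by linarith)
    have h2 : g T₀ ≤ Real.exp (1 / 2) * Real.exp (|x - T| / 2) * g T := by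
      refine (hpot T hYT T₀ (le_max_right _ _)).trans ?_
      have h3 : |T₀ - T| ≤ |x - T| := by
        rw [abs_of_nonpos (by linarith), abs_of_nonpos (by linarith)]
        linarith
      have := (hpos T).le
      gcongr
    have h3 : K ≤ K / g T₀ * (Real.exp (1 / 2) * Real.exp (|x - T| / 2) * g T) := by
      calc K = K / g T₀ * g T₀ := by rw [div_mul_cancel₀ _ (hpos T₀).ne']
        _ ≤ _ := by gcongr
    have h4 : 0 ≤ (d + 1) * (Real.exp (1 / 2) * Real.exp (|x - T| / 2) * g T) := by positivity
    nlinarith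

theorem ofReal_exp_neg_sub_exp_neg {a b : ℝ} (hab : a ≤ b) :
    ENNReal.ofReal (Real.exp (-a) - Real.exp (-b)) =
      ∫⁻ w in Set.Ioc a b, ENNReal.ofReal (Real.exp (-w)) := by
  rw [← ofReal_integral_eq_lintegral_ofReal, ← intervalIntegral.integral_of_le hab,
    intervalIntegral.integral_comp_neg, integral_exp]
  · exact (by fun_prop : Continuous fun w : ℝ => Real.exp (-w)).integrableOn_Ioc
  · exact ae_of_all _ fun w => (Real.exp_pos _).le

/-- Write the kernel as the integral of `e^{-w}` between its two exponents and apply Tonelli: `e^{T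
- y} < w ≤ e^{T + d - y}` is a condition that `y` lies in an interval of length `d`. -/
theorem lintegral_exp_neg_exp_eq [SFinite ν] (T : ℝ) {d : ℝ} (hd : 0 ≤ d) :
    ∫⁻ y, ENNReal.ofReal (Real.exp (-Real.exp (T - y)) - Real.exp (-Real.exp (T + d - y))) ∂ν =
      ∫⁻ w in Set.Ioi 0, ENNReal.ofReal (Real.exp (-w)) *
        ν (Set.Ioc (T - Real.log w + 0) (T - Real.log w + d)) := by
  have hS : MeasurableSet {x : ℝ × ℝ | Real.exp (T - x.1) < x.2 ∧ x.2 ≤ Real.exp (T + d - x.1)} :=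
    (measurableSet_lt (by fun_prop) measurable_snd).inter
      (measurableSet_le measurable_snd (by fun_prop))
  have hmm : Measurable (Function.uncurry fun y w : ℝ =>
      (Set.Ioc (Real.exp (T - y)) (Real.exp (T + d - y))).indicator
        (fun w => ENNReal.ofReal (Real.exp (-w))) w) := by
    have : (Function.uncurry fun y w : ℝ =>
      (Set.Ioc (Real.exp (T - y)) (Real.exp (T + d - y))).indicator
        (fun w => ENNReal.ofReal (Real.exp (-w))) w) =
      {x : ℝ × ℝ | Real.exp (T - x.1) < x.2 ∧ x.2 ≤ Real.exp (T + d - x.1)}.indicator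
        (fun x => ENNReal.ofReal (Real.exp (-x.2))) := by
      ext ⟨y, z⟩
      simp only [Function.uncurry_apply_pair, Set.indicator, Set.mem_Ioc, Set.mem_ofPred_eq]
    rw [this]
    exact Measurable.indicator (by fun_prop) hS
  have e1 : ∀ y, ENNReal.ofReal (Real.exp (-Real.exp (T - y)) - Real.exp (-Real.exp (T + d - y))) =
      ∫⁻ w, (Set.Ioc (Real.exp (T - y)) (Real.exp (T + d - y))).indicator
        (fun w => ENNReal.ofReal (Real.exp (-w))) w := by
    intro y
    rw [lintegral_indicator measurableSet_Ioc,
      ofReal_exp_neg_sub_exp_neg (Real.exp_le_exp.2 (by linarith))]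
  simp_rw [e1]
  rw [lintegral_lintegral_swap hmm.aemeasurable, ← lintegral_indicator measurableSet_Ioi]
  congr 1 with w
  by_cases hw : w ∈ Set.Ioi (0 : ℝ)
  · rw [Set.indicator_of_mem hw, ← setLIntegral_const, ← lintegral_indicator measurableSet_Ioc]
    congr 1 with y
    have hiff : w ∈ Set.Ioc (Real.exp (T - y)) (Real.exp (T + d - y)) ↔
        y ∈ Set.Ioc (T - Real.log w + 0) (T - Real.log w + d) := by
      rw [Set.mem_Ioc, Set.mem_Ioc, ← Real.lt_log_iff_exp_lt hw, ← Real.log_le_iff_le_exp hw]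
      constructor <;> rintro ⟨h1, h2⟩ <;> constructor <;> linarith
    simp only [Set.indicator, hiff]
  · rw [Set.indicator_of_notMem hw]
    have : ∀ y, (Set.Ioc (Real.exp (T - y)) (Real.exp (T + d - y))).indicator
        (fun w => ENNReal.ofReal (Real.exp (-w))) w = 0 := fun y =>
      Set.indicator_of_notMem (fun hy => hw ((Real.exp_pos _).trans hy.1)) _
    simp [this]

theorem tendsto_lintegral_exp_neg_exp [SFinite ν] (h : HasLocalDensity ν g) (hm : Measurable g)
    (hpos : ∀ x, 0 < g x) {d : ℝ} (hd : 0 < d) :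
    Tendsto (fun T => (∫⁻ y, ENNReal.ofReal
        (Real.exp (-Real.exp (T - y)) - Real.exp (-Real.exp (T + d - y))) ∂ν).toReal / g T)
      atTop (𝓝 d) := by
  obtain ⟨C, T₀, hC⟩ := h.exists_le_mul_exp hm hpos hd
  let F : ℝ → ℝ → ℝ := fun T w => Real.exp (-w) *
    ν.real (Set.Ioc (T - Real.log w + 0) (T - Real.log w + d))
  have hFm : ∀ T, Measurable (F T) := fun T =>
    (by fun_prop : Measurable fun w : ℝ => Real.exp (-w)).mul
      ((h.measurable_real_Ioc 0 d).comp (measurable_const.sub Real.measurable_log))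
  have hF0 : ∀ T w, 0 ≤ F T w := fun T w => mul_nonneg (Real.exp_pos _).le measureReal_nonneg
  have hCpos : 0 ≤ C := by
    have h1 := measureReal_nonneg.trans (hC T₀ le_rfl T₀)
    simp only [sub_self, abs_zero, zero_div, Real.exp_zero, mul_one] at h1
    exact nonneg_of_mul_nonneg_left h1 (hpos T₀)
  -- The sum of both powers covers `w ≥ 1` and `w ≤ 1` at once; the exponents are written as in the
  -- Gamma integrals at 3/2 and 1/2.
  let b : ℝ → ℝ := fun w => C * (Real.exp (-w) * w ^ ((3 / 2 : ℝ) - 1) +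
    Real.exp (-w) * w ^ ((1 / 2 : ℝ) - 1))
  have hbi : IntegrableOn b (Set.Ioi 0) :=
    ((Real.GammaIntegral_convergent (by norm_num)).add
      (Real.GammaIntegral_convergent (by norm_num))).const_mul C
  have hFb : ∀ T, T₀ ≤ T → ∀ w, 0 < w → F T w ≤ b w * g T := by
    intro T hT w hw
    have h1 := hC T hT (T - Real.log w)
    have h2 : Real.exp (|T - Real.log w - T| / 2) ≤ w ^ ((3 / 2 : ℝ) - 1) + w ^ ((1 / 2 : ℝ) - 1) := by
      rw [Real.rpow_def_of_pos hw, Real.rpow_def_of_pos hw]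
      have h3 := (Real.exp_pos (Real.log w * (3 / 2 - 1))).le
      have h4 := (Real.exp_pos (Real.log w * (1 / 2 - 1))).le
      rw [show T - Real.log w - T = -Real.log w by ring, abs_neg]
      rcases abs_cases (Real.log w) with ⟨h5, -⟩ | ⟨h5, -⟩ <;> rw [h5]
      · rw [show Real.log w / 2 = Real.log w * (3 / 2 - 1) by ring]
        linarith
      · rw [show -Real.log w / 2 = Real.log w * (1 / 2 - 1) by ring]
        linarith
    have := (hpos T).le
    calc F T w ≤ Real.exp (-w) * (C * Real.exp (|T - Real.log w - T| / 2) * g T) := by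
          simp only [F]; gcongr
      _ ≤ Real.exp (-w) * (C * (w ^ ((3 / 2 : ℝ) - 1) + w ^ ((1 / 2 : ℝ) - 1)) * g T) := by gcongr
      _ = b w * g T := by simp only [b]; ring
  have hlim : Tendsto (fun T => ∫ w in Set.Ioi 0, F T w / g T) atTop
      (𝓝 (∫ w in Set.Ioi (0 : ℝ), Real.exp (-w) * d)) := by
    refine tendsto_integral_filter_of_dominated_convergence b ?_ ?_ hbi ?_
    · exact Eventually.of_forall fun T => ((hFm T).div_const _).aestronglyMeasurable
    · filter_upwards [eventually_ge_atTop T₀] with T hT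
      filter_upwards [ae_restrict_mem measurableSet_Ioi] with w hw
      rw [Real.norm_of_nonneg (div_nonneg (hF0 T w) (hpos T).le), div_le_iff₀ (hpos T)]
      exact hFb T hT w hw
    · filter_upwards with w
      have e1 := (h.tendsto 0 d hd).comp
        (tendsto_atTop_add_const_right atTop (-Real.log w) tendsto_id)
      have e2 := h.tendsto_shift_div hpos (-Real.log w)
      have e3 := (e1.mul e2).const_mul (Real.exp (-w))
      rw [sub_zero, mul_one] at e3
      refine e3.congr fun T => ?_
      simp only [Function.comp, id, F]
      rw [div_mul_div_cancel₀ (hpos _).ne', mul_div_assoc, ← sub_eq_add_neg]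
  have hval : ∫ w in Set.Ioi (0 : ℝ), Real.exp (-w) * d = d := by
    rw [integral_mul_const, integral_exp_neg_Ioi_zero, one_mul]
  rw [hval] at hlim
  refine hlim.congr' ?_
  filter_upwards [eventually_ge_atTop T₀] with T hT
  have hFi : IntegrableOn (F T) (Set.Ioi 0) := by
    refine Integrable.mono' (hbi.mul_const (g T)) (hFm T).aestronglyMeasurable ?_
    filter_upwards [ae_restrict_mem measurableSet_Ioi] with w hw
    rw [Real.norm_of_nonneg (hF0 T w)]
    exact hFb T hT w hw
  rw [integral_div, lintegral_exp_neg_exp_eq T hd.le]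
  congr 1
  rw [integral_eq_lintegral_of_nonneg_ae (ae_of_all _ (hF0 T)) (hFm T).aestronglyMeasurable]
  congr 1
  refine lintegral_congr fun w => ?_
  rw [ENNReal.ofReal_mul (Real.exp_pos _).le, ofReal_measureReal (h.Ioc_lt_top _ _).ne]

end HasLocalDensity

/-! ### The point measures of logarithmic word probabilities and their densities. -/

/-- The point measure with atoms `-log (p k)`, for `p k > 0`. -/
noncomputable def logMeasure (p : ℕ → ℝ) : Measure ℝ :=
  Measure.sum fun k => if 0 < p k then Measure.dirac (-Real.log (p k)) else 0

/-- The point measure with atoms `-log (p r₁ ⋯ p rⱼ)`, for all words `r` of length `j`. -/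
noncomputable def wordLogMeasure (p : ℕ → ℝ) : ℕ → Measure ℝ
  | 0 => Measure.dirac 0
  | j + 1 => logMeasure p ∗ wordLogMeasure p j

instance sFinite_logMeasure (p : ℕ → ℝ) : SFinite (logMeasure p) := by
  have : ∀ k, SFinite (if 0 < p k then Measure.dirac (-Real.log (p k)) else 0) := by
    intro k
    split_ifs <;> infer_instance
  unfold logMeasure
  infer_instance

instance sFinite_wordLogMeasure (p : ℕ → ℝ) (j : ℕ) : SFinite (wordLogMeasure p j) := by
  induction j with
  | zero => unfold wordLogMeasure; infer_instance
  | succ j ih => unfold wordLogMeasure; infer_instance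

theorem lintegral_logMeasure {p : ℕ → ℝ} (hp : ∀ k, 0 ≤ p k) {φ : ℝ → ENNReal}
    (hφ : Measurable φ) (h0 : φ 0 = 0) :
    ∫⁻ y, φ (Real.exp (-y)) ∂(logMeasure p) = ∑' k, φ (p k) := by
  have hm : Measurable fun y => φ (Real.exp (-y)) := hφ.comp (by fun_prop)
  rw [logMeasure, lintegral_sum_measure]
  congr 1 with k
  split_ifs with hk
  · rw [lintegral_dirac' _ hm, neg_neg, Real.exp_log hk]
  · rw [le_antisymm (not_lt.1 hk) (hp k), h0, lintegral_zero_measure]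

/-- Splitting off the first letter of a word corresponds to one convolution, since logarithms turn
products into sums. Words of probability 0 carry no atom; `φ 0 = 0` lets them stay in the sum. -/
theorem lintegral_wordLogMeasure {p : ℕ → ℝ} (hp : ∀ k, 0 ≤ p k) (j : ℕ) {φ : ℝ → ENNReal}
    (hφ : Measurable φ) (h0 : φ 0 = 0) :
    ∫⁻ y, φ (Real.exp (-y)) ∂(wordLogMeasure p j) = ∑' r : Fin j → ℕ, φ (∏ i, p (r i)) := by
  induction j generalizing φ with
  | zero =>
    have hm : Measurable fun y => φ (Real.exp (-y)) := hφ.comp (by fun_prop)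
    simp [wordLogMeasure, lintegral_dirac' _ hm]
  | succ j ih =>
    have hm : Measurable fun y => φ (Real.exp (-y)) := hφ.comp (by fun_prop)
    rw [wordLogMeasure, Measure.lintegral_conv hm]
    have e1 : ∀ x, ∫⁻ y, φ (Real.exp (-(x + y))) ∂(wordLogMeasure p j) =
        ∑' r : Fin j → ℕ, φ (Real.exp (-x) * ∏ i, p (r i)) := by
      intro x
      rw [← ih (φ := fun z => φ (Real.exp (-x) * z)) (hφ.comp (measurable_const_mul _))
        (by simpa using h0)]
      simp_rw [neg_add, Real.exp_add]
    simp_rw [e1]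
    rw [lintegral_logMeasure hp (φ := fun z => ∑' r : Fin j → ℕ, φ (z * ∏ i, p (r i)))
      (Measurable.tsum fun r => hφ.comp (measurable_mul_const _)) (by simp [h0])]
    rw [← ENNReal.tsum_prod (f := fun k (r : Fin j → ℕ) => φ (p k * ∏ i, p (r i))),
      ← (Fin.consEquiv fun _ : Fin (j + 1) => ℕ).tsum_eq]
    refine tsum_congr fun x => ?_
    simp [Fin.prod_univ_succ, Fin.consEquiv]

theorem IsInfiniteDistribution.finite_le {p : ℕ → ℝ} (hp : IsInfiniteDistribution p) {x : ℝ}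
    (hx : 0 < x) : {k | x ≤ p k}.Finite := by
  have := hp.hasSum.summable.tendsto_cofinite_zero.eventually_lt_const hx
  simpa [Filter.Eventually, mem_cofinite, Set.compl_def, Set.compl_ofPred] using this

theorem logMeasure_Iic {p : ℕ → ℝ} (hp : IsInfiniteDistribution p) (T : ℝ) :
    logMeasure p (Set.Iic T) = countingFunction p (Real.exp T) := by
  have hx : 0 < 1 / Real.exp T := by positivity
  have h1 := lintegral_logMeasure hp.nonneg (φ := (Set.Ici (1 / Real.exp T)).indicator 1)
    (measurable_one.indicator measurableSet_Ici)
    (Set.indicator_of_notMem (by simpa using hx) _)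
  have h2 : ∀ y, (Set.Ici (1 / Real.exp T)).indicator (1 : ℝ → ENNReal) (Real.exp (-y)) =
      (Set.Iic T).indicator 1 y := by
    intro y
    refine Set.indicator_eq_indicator ?_ rfl
    rw [Set.mem_Ici, Set.mem_Iic, one_div, ← Real.exp_neg, Real.exp_le_exp, neg_le_neg_iff]
  simp_rw [h2] at h1
  rw [lintegral_indicator_one measurableSet_Iic] at h1
  have h3 : ∀ k, (Set.Ici (1 / Real.exp T)).indicator (1 : ℝ → ENNReal) (p k) =
      {k | 1 / Real.exp T ≤ p k}.indicator (fun _ => 1) k := fun k =>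
    Set.indicator_eq_indicator Iff.rfl rfl
  simp_rw [h3] at h1
  rw [h1, ← tsum_subtype, ENNReal.tsum_set_one, countingFunction,
    ← (hp.finite_le hx).cast_ncard_eq]
  rfl

theorem IsInfiniteDistribution.le_one {p : ℕ → ℝ} (hp : IsInfiniteDistribution p) (k : ℕ) :
    p k ≤ 1 :=
  le_hasSum hp.hasSum k fun i _ => hp.nonneg i

theorem logMeasure_Iio_zero {p : ℕ → ℝ} (hp : IsInfiniteDistribution p) :
    logMeasure p (Set.Iio 0) = 0 := by
  rw [logMeasure, Measure.sum_apply _ measurableSet_Iio, ENNReal.tsum_eq_zero]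
  intro k
  split_ifs with hk
  · rw [Measure.dirac_apply' _ measurableSet_Iio, Set.indicator_of_notMem]
    simpa using Real.log_nonpos hk.le (hp.le_one k)
  · simp

/-- The mass of `(-∞, T]` is `ρ(e^T)`, so the hypothesis at `t = e^T`, with factors `e^d` and `e^c`,
yields the limit `d - c` by subtraction. -/
theorem hasLocalDensity_logMeasure {p : ℕ → ℝ} (hp : IsInfiniteDistribution p) {g f : ℝ → ℝ}
    (hρ : ∀ a : ℝ, 0 < a → Tendsto (fun t : ℝ =>
      ((countingFunction p (a * t) : ℝ) - (countingFunction p t : ℝ)) / f (Real.log t))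
        atTop (𝓝 (Real.log a))) (hgf : g =ᶠ[atTop] f) :
    HasLocalDensity (logMeasure p) g where
  null_neg := logMeasure_Iio_zero hp
  lt_top T := by rw [logMeasure_Iic hp]; exact ENNReal.natCast_lt_top _
  tendsto c d hcd := by
    have h1 : ∀ c : ℝ, Tendsto (fun T => ((countingFunction p (Real.exp (T + c)) : ℝ) -
        (countingFunction p (Real.exp T) : ℝ)) / f T) atTop (𝓝 c) := by
      intro c
      have := (hρ (Real.exp c) (Real.exp_pos c)).comp Real.tendsto_exp_atTop
      rw [Real.log_exp] at this
      refine this.congr fun T => ?_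
      simp only [Function.comp, Real.log_exp, Real.exp_add, mul_comm]
    refine ((h1 d).sub (h1 c)).congr' ?_
    filter_upwards [hgf] with T hT
    have hsub : T + c ≤ T + d := by linarith
    rw [hT, ← sub_div, ← Set.Iic_sdiff_Iic, measureReal_sdiff (Set.Iic_subset_Iic.2 hsub)
      measurableSet_Iic (by rw [logMeasure_Iic hp]; exact ENNReal.natCast_ne_top _),
      measureReal_def, measureReal_def, logMeasure_Iic hp, logMeasure_Iic hp,
      ENNReal.toReal_natCast, ENNReal.toReal_natCast]
    congr 1
    ring

/-- Freezing `ℓ` to the left of `x₀` makes it measurable and positive on the whole line. -/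
theorem IsSlowlyVarying.exists_regularlyVarying {ℓ : ℝ → ℝ} (hℓ : IsSlowlyVarying ℓ) :
    ∃ L : ℝ → ℝ, IsRegularlyVarying L 0 ∧ L =ᶠ[atTop] ℓ := by
  obtain ⟨x₀, hm, hpos⟩ := hℓ.measurable_pos
  have heq : (fun x => ℓ (max x x₀)) =ᶠ[atTop] ℓ := by
    filter_upwards [eventually_ge_atTop x₀] with x hx
    rw [max_eq_left hx]
  refine ⟨fun x => ℓ (max x x₀), ⟨?_, fun x => hpos _ (le_max_right _ _), fun a ha => ?_⟩, heq⟩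
  · exact hm.comp ((measurable_id.max measurable_const).subtype_mk (h := fun x => le_max_right x x₀))
  · rw [Real.rpow_zero]
    refine (hℓ.tendsto_div a ha).congr' ?_
    filter_upwards [heq, (tendsto_id.const_mul_atTop ha).eventually heq] with x h1 h2
    simp only [id] at h2
    rw [h1, h2]

/-- Monotonicity gives `g x ≤ g (2 T)`, and regular variation compares `g (2 T)` with `g T`. This
serves index 0, where Potter's bound does not suffice. -/
theorem EventuallyNondecreasingUnbounded.isQuasiMonotone {ℓ g : ℝ → ℝ} {α : ℝ}
    (hℓ : EventuallyNondecreasingUnbounded ℓ) (hg : IsRegularlyVarying g α)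
    (heq : g =ᶠ[atTop] ℓ) : IsQuasiMonotone g := by
  obtain ⟨x₀, hmono, -⟩ := hℓ
  obtain ⟨x₁, hx₁⟩ := eventually_atTop.1 heq
  obtain ⟨x₂, hx₂⟩ := eventually_atTop.1
    ((hg.tendsto_div 2 two_pos).eventually_le_const (lt_add_one _))
  refine ⟨(2 : ℝ) ^ α + 1, max (max x₀ x₁) (max x₂ 1), by positivity, fun T x hT hx hxT => ?_⟩
  simp only [max_le_iff] at hT hx
  have h1 := hx₂ T hT.2.1
  rw [div_le_iff₀ (hg.pos T)] at h1
  refine le_trans ?_ h1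
  rw [hx₁ x hx.1.2, hx₁ (2 * T) (by linarith)]
  exact hmono hx.1.1 (hx.1.1.trans hxT) hxT

theorem integral_Ioo_rpow_mul_one_sub_rpow {a b : ℝ} (ha : 0 < a) (hb : 0 < b) :
    ∫ s in Set.Ioo (0 : ℝ) 1, s ^ (a - 1) * (1 - s) ^ (b - 1) =
      Real.Gamma a * Real.Gamma b / Real.Gamma (a + b) := by
  have h := beta_eq_betaIntegralReal a b ha hb
  rw [beta] at h
  rw [h, Complex.betaIntegral, intervalIntegral.integral_of_le zero_le_one,
    integral_Ioc_eq_integral_Ioo, ← RCLike.re_eq_complex_re, ← integral_re]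
  · refine setIntegral_congr_fun measurableSet_Ioo fun s hs => ?_
    rw [← Complex.ofReal_one, ← Complex.ofReal_sub, ← Complex.ofReal_sub, ← Complex.ofReal_sub,
      ← Complex.ofReal_cpow hs.1.le, ← Complex.ofReal_cpow (sub_pos.2 hs.2).le,
      ← Complex.ofReal_mul, RCLike.re_eq_complex_re, Complex.ofReal_re]
  · have := Complex.betaIntegral_convergent (u := (a : ℂ)) (v := (b : ℂ)) (by simpa) (by simpa)
    rw [intervalIntegrable_iff_integrableOn_Ioc_of_le zero_le_one] at this
    exact (integrableOn_Ioc_iff_integrableOn_Ioo).1 this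

/-- The density of `wordLogMeasure p j` at `+∞`, where `L` is the slowly varying factor of the
density of `logMeasure p`, of index `β`. -/
noncomputable def wordDensity (β : ℝ) (L : ℝ → ℝ) (j : ℕ) (x : ℝ) : ℝ :=
  Real.Gamma (β + 1) ^ j / Real.Gamma (j * (β + 1)) * ((max x 1) ^ (j * β + j - 1) * L x ^ j)

theorem IsRegularlyVarying.pow_of_zero {L : ℝ → ℝ} (hL : IsRegularlyVarying L 0) (j : ℕ) :
    IsRegularlyVarying (fun x => L x ^ j) 0 where
  measurable := hL.measurable.pow_const j
  pos x := pow_pos (hL.pos x) j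
  tendsto_div a ha := by
    have := (hL.tendsto_div a ha).pow j
    rw [Real.rpow_zero, one_pow] at this
    rw [Real.rpow_zero]
    exact this.congr fun x => div_pow _ _ _

theorem wordDensity_const_pos {β : ℝ} (hβ : 0 ≤ β) {j : ℕ} (hj : 1 ≤ j) :
    0 < Real.Gamma (β + 1) ^ j / Real.Gamma (j * (β + 1)) := by
  have : (0 : ℝ) < j := by exact_mod_cast hj
  have h1 := Real.Gamma_pos_of_pos (by linarith : 0 < β + 1)
  have h2 := Real.Gamma_pos_of_pos (by positivity : 0 < (j : ℝ) * (β + 1))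
  positivity

theorem isRegularlyVarying_wordDensity {β : ℝ} (hβ : 0 ≤ β) {L : ℝ → ℝ}
    (hL : IsRegularlyVarying L 0) {j : ℕ} (hj : 1 ≤ j) :
    IsRegularlyVarying (wordDensity β L j) (j * β + j - 1) := by
  have := ((isRegularlyVarying_max_one_rpow (j * β + j - 1)).mul (hL.pow_of_zero j)).const_mul
    (wordDensity_const_pos hβ hj)
  rwa [add_zero] at this

theorem hasLocalDensity_wordLogMeasure {p : ℕ → ℝ} {β : ℝ} (hβ : 0 ≤ β) {L : ℝ → ℝ}
    (hL : IsRegularlyVarying L 0) (h : HasLocalDensity (logMeasure p) (wordDensity β L 1))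
    (hq : IsQuasiMonotone (wordDensity β L 1)) {j : ℕ} (hj : 1 ≤ j) :
    HasLocalDensity (wordLogMeasure p j) (wordDensity β L j) := by
  induction j, hj using Nat.le_induction with
  | base => simpa [wordLogMeasure] using h
  | succ j hj ih =>
    have hj0 : (1 : ℝ) ≤ j := by exact_mod_cast hj
    have hr1 := isRegularlyVarying_wordDensity hβ hL le_rfl
    have hrj := isRegularlyVarying_wordDensity hβ hL hj
    -- From the second generation on the index `jβ + j - 1` is positive, so quasi-monotonicity has
    -- to be assumed for the first generation only.
    have hqj : IsQuasiMonotone (wordDensity β L j) := by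
      rcases hj.eq_or_lt with rfl | hj'
      · exact hq
      · have : (1 : ℝ) < j := by exact_mod_cast hj'
        exact hrj.isQuasiMonotone (by nlinarith)
    have hG1 := Real.Gamma_pos_of_pos (by linarith : 0 < β + 1)
    have hGj := Real.Gamma_pos_of_pos (by positivity : 0 < (j : ℝ) * (β + 1))
    have hGj1 := Real.Gamma_pos_of_pos (by positivity : 0 < ((j : ℝ) + 1) * (β + 1))
    rw [wordLogMeasure]
    -- `B` is the Beta function at `β + 1` and `j (β + 1)`; its factor `Γ(j (β + 1))` cancels the
    -- denominator from generation `j`.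
    refine h.conv ih hr1 hrj hq hqj (B := Real.Gamma (β + 1) * Real.Gamma (j * (β + 1)) /
      Real.Gamma ((j + 1) * (β + 1))) (by positivity) ?_ ?_
    · have := integral_Ioo_rpow_mul_one_sub_rpow (by linarith : 0 < β + 1)
        (by positivity : 0 < (j : ℝ) * (β + 1))
      rw [show β + 1 + j * (β + 1) = (j + 1) * (β + 1) by ring] at this
      rw [← this]
      congr 1 with s
      congr 2 <;> push_cast <;> ring
    · filter_upwards [eventually_ge_atTop 1] with T hT
      simp only [wordDensity, max_eq_left hT, Nat.cast_one, one_mul, pow_one, Nat.cast_add]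
      have hT0 : 0 < T := by linarith
      rw [show (j + 1) * β + (j + 1) - 1 = 1 + (β + 1 - 1) + (j * β + j - 1) by ring,
        Real.rpow_add hT0, Real.rpow_add hT0, Real.rpow_one]
      field_simp
      ring

/-! ### Hitting probabilities and moments in the Poissonized scheme. -/

/-- The first `j` choices of the ball number `n`, that is, its box of generation `j`. -/
def ballWord {Ω : Type*} (X : ℕ → ℕ → Ω → ℕ) (j n : ℕ) (ω : Ω) : Fin j → ℕ := fun i => X n i ω

/-- The event that the box `r` has been hit by time `t`. -/
def hitSet {Ω : Type*} (π : ℝ≥0 → Ω → ℕ) (X : ℕ → ℕ → Ω → ℕ) (j : ℕ) (t : ℝ≥0)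
    (r : Fin j → ℕ) : Set Ω := {ω | ∃ n < π t ω, ballWord X j n ω = r}

/-- The probability that a ball falls into the box `r`. -/
noncomputable def wordProb (p : ℕ → ℝ) {j : ℕ} (r : Fin j → ℕ) : ℝ := ∏ i, p (r i)

theorem tsum_poissonMeasure_mul_pow (s : ℝ≥0) {x : ℝ} (hx : 0 ≤ x) :
    ∑' n, poissonMeasure s {n} * ENNReal.ofReal x ^ n = ENNReal.ofReal (Real.exp (s * (x - 1))) := by
  have h : HasSum (fun n : ℕ => Real.exp (-s) * s ^ n / n.factorial * x ^ n)
      (Real.exp (s * (x - 1))) := by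
    have := (NormedSpace.expSeries_div_hasSum_exp ((s : ℝ) * x)).mul_left (Real.exp (-s))
    rw [← Real.exp_eq_exp_ℝ, ← Real.exp_add, show -(s : ℝ) + s * x = s * (x - 1) by ring] at this
    refine this.congr_fun fun n => ?_
    rw [mul_pow]
    ring
  rw [← h.tsum_eq, ENNReal.ofReal_tsum_of_nonneg (fun n => by positivity) h.summable]
  congr 1 with n
  rw [poissonMeasure_singleton, ENNReal.ofReal_mul (by positivity), ENNReal.ofReal_pow hx]

section Scheme

variable {Ω : Type*} {p : ℕ → ℝ} {π : ℝ≥0 → Ω → ℕ} {X : ℕ → ℕ → Ω → ℕ}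

/-- As an extended nonnegative sum of indicators, the count admits Tonelli without prior
integrability. -/
theorem ofReal_occupiedCount (j : ℕ) (t : ℝ≥0) (ω : Ω) :
    ENNReal.ofReal (occupiedCount π X j t ω) =
      ∑' r, (hitSet π X j t r).indicator (fun _ => 1) ω := by
  have hfin : (occupiedBoxes X j (π t ω) ω).Finite := by
    refine ((Finset.range (π t ω)).finite_toSet.image fun n => ballWord X j n ω).subset ?_
    rintro r ⟨n, hn, hr⟩
    exact ⟨n, by simpa using hn, funext hr⟩
  have h : ∀ r, (hitSet π X j t r).indicator (fun _ => (1 : ENNReal)) ω =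
      (occupiedBoxes X j (π t ω) ω).indicator (fun _ => 1) r := by
    intro r
    refine Set.indicator_eq_indicator ?_ rfl
    simp [hitSet, occupiedBoxes, ballWord, funext_iff]
  simp_rw [h]
  rw [← tsum_subtype, ENNReal.tsum_set_one, occupiedCount, ENNReal.ofReal_natCast,
    ← hfin.cast_ncard_eq]
  rfl

variable [MeasurableSpace Ω] {μ : Measure Ω}

namespace IsPoissonizedNestedScheme

theorem prob_nonneg (hX : IsPoissonizedNestedScheme p π X μ) (k : ℕ) : 0 ≤ p k := by
  rw [← hX.law_choice 0 0 k]
  exact measureReal_nonneg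

theorem wordProb_nonneg (hX : IsPoissonizedNestedScheme p π X μ) {j : ℕ} (r : Fin j → ℕ) :
    0 ≤ wordProb p r :=
  Finset.prod_nonneg fun i _ => hX.prob_nonneg (r i)

theorem measurable_ballWord (hX : IsPoissonizedNestedScheme p π X μ) (j n : ℕ) :
    Measurable (ballWord X j n) :=
  measurable_pi_lambda _ fun i => hX.measurable_choice n i

theorem measurableSet_hitSet (hX : IsPoissonizedNestedScheme p π X μ) {j : ℕ} (t : ℝ≥0)
    (r : Fin j → ℕ) : MeasurableSet (hitSet π X j t r) := by
  have : hitSet π X j t r = ⋃ n, {ω | n < π t ω} ∩ ballWord X j n ⁻¹' {r} := by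
    ext ω
    simp [hitSet]
  rw [this]
  exact MeasurableSet.iUnion fun n =>
    (measurableSet_lt measurable_const (hX.poisson.measurable t)).inter
      (hX.measurable_ballWord j n (measurableSet_singleton r))

theorem measurable_occupiedCount (hX : IsPoissonizedNestedScheme p π X μ) (j : ℕ) (t : ℝ≥0) :
    Measurable (occupiedCount π X j t) := by
  have h : Measurable fun ω => ENNReal.ofReal (occupiedCount π X j t ω) := by
    simp_rw [ofReal_occupiedCount]
    exact Measurable.tsum fun r => measurable_const.indicator (hX.measurableSet_hitSet t r)
  have h2 := h.ennreal_toReal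
  have h3 : ∀ ω, (ENNReal.ofReal (occupiedCount π X j t ω)).toReal = occupiedCount π X j t ω :=
    fun ω => ENNReal.toReal_ofReal (Nat.cast_nonneg _)
  simp_rw [h3] at h2
  exact h2

theorem measure_arrivals_eq (hX : IsPoissonizedNestedScheme p π X μ) {s t : ℝ≥0} (hst : s ≤ t)
    (n m : ℕ) : μ {ω | π s ω = n ∧ π t ω - π s ω = m} =
      poissonMeasure s {n} * poissonMeasure (t - s) {m} := by
  have hind := hX.poisson.indep_increments.indepFun_sub_sub (zero_le : (0 : ℝ≥0) ≤ s) hst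
  have h := hind.measure_inter_preimage_eq_mul {n} {m} .of_discrete .of_discrete
  have l1 := (hX.poisson.law_increments 0 s zero_le).map_eq
  have l2 := (hX.poisson.law_increments s t hst).map_eq
  have m1 : Measurable (fun ω => π s ω - π 0 ω) :=
    (hX.poisson.measurable s).sub (hX.poisson.measurable 0)
  have m2 : Measurable (fun ω => π t ω - π s ω) :=
    (hX.poisson.measurable t).sub (hX.poisson.measurable s)
  rw [tsub_zero] at l1
  rw [← l1, ← l2, Measure.map_apply m1 .of_discrete, Measure.map_apply m2 .of_discrete]
  refine Eq.trans ?_ h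
  refine measure_congr ?_
  filter_upwards [hX.poisson.zero] with ω hω
  refine propext ?_
  change π s ω = n ∧ π t ω - π s ω = m ↔ π s ω - π 0 ω = n ∧ π t ω - π s ω = m
  rw [hω, tsub_zero]

variable [IsProbabilityMeasure μ]

theorem measure_ballWord_eq (hX : IsPoissonizedNestedScheme p π X μ) {j : ℕ} (n : ℕ)
    (r : Fin j → ℕ) : μ (ballWord X j n ⁻¹' {r}) = ENNReal.ofReal (wordProb p r) := by
  have hind : iIndepFun (fun i : Fin j => X n i) μ :=
    hX.indep_choices.precomp (g := fun i : Fin j => (n, (i : ℕ))) (by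
      intro a b hab
      simpa [Fin.ext_iff] using hab)
  have hset : ballWord X j n ⁻¹' {r} = ⋂ i : Fin j, X n i ⁻¹' {r i} := by
    ext ω
    simp [ballWord, funext_iff]
  rw [hset, hind.meas_iInter fun i => ⟨{r i}, measurableSet_singleton _, rfl⟩, wordProb,
    ENNReal.ofReal_prod_of_nonneg fun i _ => hX.prob_nonneg _]
  refine Finset.prod_congr rfl fun i _ => ?_
  rw [← hX.law_choice n i (r i), ofReal_measureReal]
  rfl

theorem tsum_wordProb (hX : IsPoissonizedNestedScheme p π X μ) (j : ℕ) :
    ∑' r : Fin j → ℕ, ENNReal.ofReal (wordProb p r) = 1 := by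
  simp_rw [← hX.measure_ballWord_eq 0]
  have := tsum_measure_preimage_singleton (μ := μ) (s := (Set.univ : Set (Fin j → ℕ)))
    Set.countable_univ (f := ballWord X j 0)
    fun y _ => hX.measurable_ballWord j 0 (measurableSet_singleton y)
  rw [Set.preimage_univ, measure_univ] at this
  rw [← this, tsum_univ (fun r => μ (ballWord X j 0 ⁻¹' {r}))]

theorem measure_ballWord_notMem (hX : IsPoissonizedNestedScheme p π X μ) {j : ℕ} (n : ℕ)
    (S : Finset (Fin j → ℕ)) :
    μ {ω | ballWord X j n ω ∉ S} = ENNReal.ofReal (1 - ∑ r ∈ S, wordProb p r) := by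
  have hm : MeasurableSet {ω | ballWord X j n ω ∈ S} :=
    hX.measurable_ballWord j n (Set.Finite.measurableSet S.finite_toSet)
  have h1 : μ {ω | ballWord X j n ω ∈ S} = ∑ r ∈ S, ENNReal.ofReal (wordProb p r) := by
    simp_rw [← hX.measure_ballWord_eq n]
    exact (sum_measure_preimage_singleton S
      fun y _ => hX.measurable_ballWord j n (measurableSet_singleton y)).symm
  have h2 := prob_compl_eq_one_sub (μ := μ) hm
  rw [h1, ← ENNReal.ofReal_sum_of_nonneg fun r _ => hX.wordProb_nonneg r,
    ← ENNReal.ofReal_one, ← ENNReal.ofReal_sub _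
      (Finset.sum_nonneg fun r _ => hX.wordProb_nonneg r)] at h2
  exact h2

theorem sum_wordProb_le_one (hX : IsPoissonizedNestedScheme p π X μ) {j : ℕ}
    (S : Finset (Fin j → ℕ)) : ∑ r ∈ S, wordProb p r ≤ 1 := by
  have := ENNReal.sum_le_tsum (f := fun r : Fin j → ℕ => ENNReal.ofReal (wordProb p r)) S
  rw [hX.tsum_wordProb j, ← ENNReal.ofReal_sum_of_nonneg fun r _ => hX.wordProb_nonneg r,
    ← ENNReal.ofReal_one, ENNReal.ofReal_le_ofReal_iff zero_le_one] at this
  exact this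

/-- The forbidden set depends on the ball because balls arriving before and after time `s` have to
avoid different boxes. -/
theorem measure_forall_notMem (hX : IsPoissonizedNestedScheme p π X μ) {j : ℕ}
    (S : ℕ → Finset (Fin j → ℕ)) (n : ℕ) :
    μ {ω | ∀ i < n, ballWord X j i ω ∉ S i} =
      ∏ i ∈ Finset.range n, ENNReal.ofReal (1 - ∑ r ∈ S i, wordProb p r) := by
  induction n with
  | zero => simp
  | succ n ih =>
    have hind := hX.indep_choices.indepFun_finset (Finset.range n ×ˢ Finset.range j)
      ({n} ×ˢ Finset.range j) (by
        rw [Finset.disjoint_left]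
        rintro ⟨a, b⟩ h1 h2
        simp only [Finset.mem_product, Finset.mem_range, Finset.mem_singleton] at h1 h2
        omega) fun q => hX.measurable_choice q.1 q.2
    have h := hind.measure_inter_preimage_eq_mul
      {x | ∀ i (hi : i < n), (fun k : Fin j => x ⟨(i, k), by simp [hi]⟩) ∉ S i}
      {x | (fun k : Fin j => x ⟨(n, k), by simp⟩) ∉ S n} .of_discrete .of_discrete
    rw [Finset.prod_range_succ, ← ih, ← hX.measure_ballWord_notMem n (S n)]
    refine Eq.trans ?_ h
    congr 1
    ext ω
    simp only [Set.mem_ofPred_eq, Set.mem_inter_iff, Set.mem_preimage]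
    constructor
    · intro h
      exact ⟨fun i hi => h i (by omega), h n (by omega)⟩
    · rintro ⟨h1, h2⟩ i hi
      rcases Nat.lt_succ_iff_lt_or_eq.1 hi with hi | rfl
      · exact h1 i hi
      · exact h2

/-- Decompose according to the numbers `n`, `m` of arrivals up to `s` and between `s` and `t`. The
first `n` balls avoid `S` (hence `S'`), the next `m` avoid `S'`; summation gives a product of two
Poisson generating functions. -/
theorem measure_miss (hX : IsPoissonizedNestedScheme p π X μ) {s t : ℝ≥0} (hst : s ≤ t) {j : ℕ}
    (S S' : Finset (Fin j → ℕ)) (hS : S' ⊆ S) :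
    μ {ω | (∀ i < π s ω, ballWord X j i ω ∉ S) ∧ ∀ i < π t ω, ballWord X j i ω ∉ S'} =
      ENNReal.ofReal (Real.exp (-(s * ∑ r ∈ S, wordProb p r + (t - s) * ∑ r ∈ S', wordProb p r))) := by
  set x := 1 - ∑ r ∈ S, wordProb p r with hx
  set y := 1 - ∑ r ∈ S', wordProb p r with hy
  have hx0 : 0 ≤ x := sub_nonneg.2 (hX.sum_wordProb_le_one S)
  have hy0 : 0 ≤ y := sub_nonneg.2 (hX.sum_wordProb_le_one S')
  set E := {ω | (∀ i < π s ω, ballWord X j i ω ∉ S) ∧ ∀ i < π t ω, ballWord X j i ω ∉ S'}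
  have hπs := hX.poisson.measurable s
  have hπt := hX.poisson.measurable t
  let D : Ω → ℕ × ℕ := fun ω => (π s ω, π t ω - π s ω)
  have hD : Measurable D := hπs.prodMk (hπt.sub hπs)
  have hsum := tsum_measure_preimage_singleton (μ := μ.restrict E) (s := (Set.univ : Set (ℕ × ℕ)))
    Set.countable_univ (f := D) fun d _ => hD (measurableSet_singleton d)
  rw [Set.preimage_univ, Measure.restrict_apply_univ,
    tsum_univ (fun d => μ.restrict E (D ⁻¹' {d}))] at hsum
  let R : ℕ → ℕ → Finset (Fin j → ℕ) := fun n i => if i < n then S else S'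
  have hterm : ∀ d : ℕ × ℕ, μ.restrict E (D ⁻¹' {d}) =
      (poissonMeasure s {d.1} * ENNReal.ofReal x ^ d.1) *
        (poissonMeasure (t - s) {d.2} * ENNReal.ofReal y ^ d.2) := by
    rintro ⟨n, m⟩
    have hprod : μ {ω | ∀ i < n + m, ballWord X j i ω ∉ R n i} =
        ENNReal.ofReal x ^ n * ENNReal.ofReal y ^ m := by
      rw [hX.measure_forall_notMem, Finset.prod_range_add]
      congr 1
      · rw [Finset.prod_congr rfl (g := fun _ => ENNReal.ofReal x), Finset.prod_const,
          Finset.card_range]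
        intro i hi
        simp [R, Finset.mem_range.1 hi, x]
      · simp [R, y]
    have hind : IndepFun D (fun ω (q : ℕ × ℕ) => X q.1 q.2 ω) μ :=
      hX.indep_arrivals.comp (φ := fun f : ℝ≥0 → ℕ => (f s, f t - f s)) (ψ := id)
        ((measurable_pi_apply s).prodMk ((measurable_pi_apply t).sub (measurable_pi_apply s)))
        measurable_id
    have hA : MeasurableSet
        {w : ℕ × ℕ → ℕ | ∀ i < n + m, (fun k : Fin j => w (i, (k : ℕ))) ∉ R n i} := by
      have : {w : ℕ × ℕ → ℕ | ∀ i < n + m, (fun k : Fin j => w (i, (k : ℕ))) ∉ R n i} =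
          ⋂ i, ⋂ (_ : i < n + m),
            (fun (w : ℕ × ℕ → ℕ) (k : Fin j) => w (i, (k : ℕ))) ⁻¹' (R n i : Set (Fin j → ℕ))ᶜ := by
        ext w
        simp
      rw [this]
      exact MeasurableSet.iInter fun i => MeasurableSet.iInter fun _ =>
        (measurable_pi_lambda _ fun k => measurable_pi_apply _) .of_discrete
    have h := hind.measure_inter_preimage_eq_mul {(n, m)} _ .of_discrete hA
    rw [Measure.restrict_apply (hD (measurableSet_singleton _))]
    have h3 : μ (D ⁻¹' {(n, m)}) = poissonMeasure s {n} * poissonMeasure (t - s) {m} := by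
      rw [← hX.measure_arrivals_eq hst]
      congr 1
      ext ω
      simp [D]
    rw [h3] at h
    have h4 : μ ((fun ω (q : ℕ × ℕ) => X q.1 q.2 ω) ⁻¹'
        {w : ℕ × ℕ → ℕ | ∀ i < n + m, (fun k : Fin j => w (i, (k : ℕ))) ∉ R n i}) =
        ENNReal.ofReal x ^ n * ENNReal.ofReal y ^ m := hprod
    rw [h4] at h
    rw [mul_mul_mul_comm, ← h]
    refine measure_congr ?_
    filter_upwards [hX.poisson.paths] with ω hω
    refine propext (and_congr_right fun hd => ?_)
    have hle : π s ω ≤ π t ω := hω.1 hst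
    have hd1 : π s ω = n := congrArg Prod.fst hd
    have hd2 : π t ω - π s ω = m := congrArg Prod.snd hd
    have hd3 : π t ω = n + m := by omega
    change ((∀ i < π s ω, ballWord X j i ω ∉ S) ∧ ∀ i < π t ω, ballWord X j i ω ∉ S') ↔
      ∀ i < n + m, ballWord X j i ω ∉ R n i
    rw [hd3, hd1]
    constructor
    · rintro ⟨h1, h2⟩ i hi
      by_cases hin : i < n
      · simpa [R, hin] using h1 i hin
      · simpa [R, hin] using h2 i hi
    · intro h5
      refine ⟨fun i hi => ?_, fun i hi hmem => ?_⟩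
      · simpa [R, hi] using h5 i (by omega)
      · refine h5 i hi ?_
        by_cases hin : i < n
        · simpa [R, hin] using hS hmem
        · simpa [R, hin] using hmem
  rw [← hsum]
  simp_rw [hterm]
  rw [ENNReal.tsum_prod (f := fun n m => (poissonMeasure s {n} * ENNReal.ofReal x ^ n) *
        (poissonMeasure (t - s) {m} * ENNReal.ofReal y ^ m))]
  simp_rw [ENNReal.tsum_mul_left, ENNReal.tsum_mul_right]
  rw [tsum_poissonMeasure_mul_pow s hx0, tsum_poissonMeasure_mul_pow (t - s) hy0,
    ← ENNReal.ofReal_mul (Real.exp_pos _).le, ← Real.exp_add, NNReal.coe_sub hst]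
  congr 2
  rw [hx, hy]
  ring

theorem measure_hitSet_compl (hX : IsPoissonizedNestedScheme p π X μ) {j : ℕ} (t : ℝ≥0)
    (r : Fin j → ℕ) :
    μ.real (hitSet π X j t r)ᶜ = Real.exp (-(wordProb p r * t)) := by
  have h := hX.measure_miss (le_refl t) {r} {r} subset_rfl
  rw [sub_self, zero_mul, add_zero, Finset.sum_singleton] at h
  rw [measureReal_def, ← ENNReal.toReal_ofReal (Real.exp_pos (-(wordProb p r * t))).le,
    mul_comm (wordProb p r), ← h]
  congr 2
  ext ω
  simp [hitSet]

/-- Along monotone paths a box missed by time `t` is missed by time `s`, so the event reads: avoid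
`{r, r'}` up to `s` and `r'` up to `t`. The product for `r ≠ r'` is the independence gained from
Poissonization. -/
theorem measure_hitSet_compl_inter (hX : IsPoissonizedNestedScheme p π X μ) {j : ℕ} {s t : ℝ≥0}
    (hst : s ≤ t) (r r' : Fin j → ℕ) :
    μ.real ((hitSet π X j s r)ᶜ ∩ (hitSet π X j t r')ᶜ) =
      if r = r' then Real.exp (-(wordProb p r * t))
      else Real.exp (-(wordProb p r * s)) * Real.exp (-(wordProb p r' * t)) := by
  have hset : ((hitSet π X j s r)ᶜ ∩ (hitSet π X j t r')ᶜ : Set Ω) =ᵐ[μ]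
      {ω | (∀ i < π s ω, ballWord X j i ω ∉ ({r, r'} : Finset (Fin j → ℕ))) ∧
        ∀ i < π t ω, ballWord X j i ω ∉ ({r'} : Finset (Fin j → ℕ))} := by
    filter_upwards [hX.poisson.paths] with ω hω
    have hle : π s ω ≤ π t ω := hω.1 hst
    refine propext ?_
    change (ω ∉ hitSet π X j s r ∧ ω ∉ hitSet π X j t r') ↔ _ ∧ _
    simp only [hitSet, Set.mem_ofPred_eq, not_exists, not_and, Finset.mem_insert,
      Finset.mem_singleton, not_or]
    constructor
    · rintro ⟨h1, h2⟩
      exact ⟨fun i hi => ⟨h1 i hi, h2 i (hi.trans_le hle)⟩, h2⟩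
    · rintro ⟨h1, h2⟩
      exact ⟨fun i hi => (h1 i hi).1, h2⟩
  rw [measureReal_def, measure_congr hset, hX.measure_miss hst _ _ (by simp),
    ENNReal.toReal_ofReal (Real.exp_pos _).le, Finset.sum_singleton]
  split_ifs with h
  · subst h
    simp only [Finset.pair_eq_singleton, Finset.sum_singleton]
    congr 1
    ring
  · rw [Finset.sum_pair h, ← Real.exp_add]
    congr 1
    ring

theorem measure_hitSet (hX : IsPoissonizedNestedScheme p π X μ) {j : ℕ} (t : ℝ≥0)
    (r : Fin j → ℕ) :
    μ (hitSet π X j t r) = ENNReal.ofReal (1 - Real.exp (-(wordProb p r * t))) := by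
  rw [← hX.measure_hitSet_compl t r, probReal_compl_eq_one_sub (hX.measurableSet_hitSet t r),
    sub_sub_cancel, ofReal_measureReal]

/-- A product plus a nonnegative diagonal correction, the covariance of the two indicators: in this
form it can be summed over `r` and `r'` in `ENNReal`. -/
theorem measure_hitSet_inter (hX : IsPoissonizedNestedScheme p π X μ) {j : ℕ} {s t : ℝ≥0}
    (hst : s ≤ t) (r r' : Fin j → ℕ) :
    μ (hitSet π X j s r ∩ hitSet π X j t r') =
      ENNReal.ofReal (1 - Real.exp (-(wordProb p r * s))) *
        ENNReal.ofReal (1 - Real.exp (-(wordProb p r' * t))) +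
      if r = r' then ENNReal.ofReal
        (Real.exp (-(wordProb p r * t)) - Real.exp (-(wordProb p r * (s + t)))) else 0 := by
  have ha : ∀ (t : ℝ≥0) (r : Fin j → ℕ), 0 ≤ 1 - Real.exp (-(wordProb p r * t)) := fun t r =>
    sub_nonneg.2 (Real.exp_le_one_iff.2 (neg_nonpos.2 (mul_nonneg (hX.wordProb_nonneg r) t.2)))
  have h1 := hX.measure_hitSet_compl s r
  have h2 := hX.measure_hitSet_compl t r'
  have h3 := hX.measure_hitSet_compl_inter hst r r'
  have m1 := hX.measurableSet_hitSet s r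
  have m2 := hX.measurableSet_hitSet t r'
  have h4 := measureReal_union_add_inter (μ := μ) (s := (hitSet π X j s r)ᶜ) m2.compl
  rw [← Set.compl_inter, probReal_compl_eq_one_sub (m1.inter m2), h1, h2, h3] at h4
  rw [← ofReal_measureReal (measure_ne_top _ _), ← ENNReal.ofReal_mul (ha s r)]
  split_ifs at h4 ⊢ with h
  · subst h
    have e1 : Real.exp (-(wordProb p r * (s + t))) =
        Real.exp (-(wordProb p r * s)) * Real.exp (-(wordProb p r * t)) := by
      rw [← Real.exp_add]
      congr 1
      ring
    rw [← ENNReal.ofReal_add (mul_nonneg (ha s r) (ha t r))]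
    · congr 1
      rw [e1]
      linarith
    · rw [sub_nonneg, Real.exp_le_exp, mul_add]
      linarith [mul_nonneg (hX.wordProb_nonneg r) s.coe_nonneg]
  · rw [add_zero]
    congr 1
    linarith

theorem lintegral_occupiedCount (hX : IsPoissonizedNestedScheme p π X μ) (j : ℕ) (t : ℝ≥0) :
    ∫⁻ ω, ENNReal.ofReal (occupiedCount π X j t ω) ∂μ =
      ∑' r : Fin j → ℕ, ENNReal.ofReal (1 - Real.exp (-(wordProb p r * t))) := by
  simp_rw [ofReal_occupiedCount]
  rw [lintegral_tsum fun r =>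
    (measurable_const.indicator (hX.measurableSet_hitSet t r)).aemeasurable]
  congr 1 with r
  rw [lintegral_indicator_const (hX.measurableSet_hitSet t r), one_mul, hX.measure_hitSet]

theorem lintegral_occupiedCount_lt_top (hX : IsPoissonizedNestedScheme p π X μ) (j : ℕ)
    (t : ℝ≥0) : ∫⁻ ω, ENNReal.ofReal (occupiedCount π X j t ω) ∂μ < ⊤ := by
  rw [hX.lintegral_occupiedCount]
  have h : ∑' r : Fin j → ℕ, ENNReal.ofReal (1 - Real.exp (-(wordProb p r * t))) ≤
      ∑' r : Fin j → ℕ, ENNReal.ofReal (wordProb p r) * t := by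
    refine ENNReal.tsum_le_tsum fun r => ?_
    rw [← ENNReal.ofReal_coe_nnreal, ← ENNReal.ofReal_mul (hX.wordProb_nonneg r)]
    refine ENNReal.ofReal_le_ofReal ?_
    linarith [Real.add_one_le_exp (-(wordProb p r * t))]
  refine h.trans_lt ?_
  rw [ENNReal.tsum_mul_right, hX.tsum_wordProb, one_mul]
  exact ENNReal.coe_lt_top

theorem lintegral_occupiedCount_mul (hX : IsPoissonizedNestedScheme p π X μ) (j : ℕ) {s t : ℝ≥0}
    (hst : s ≤ t) :
    ∫⁻ ω, ENNReal.ofReal (occupiedCount π X j s ω * occupiedCount π X j t ω) ∂μ =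
      (∫⁻ ω, ENNReal.ofReal (occupiedCount π X j s ω) ∂μ) *
        (∫⁻ ω, ENNReal.ofReal (occupiedCount π X j t ω) ∂μ) +
      ∑' r : Fin j → ℕ, ENNReal.ofReal
        (Real.exp (-(wordProb p r * t)) - Real.exp (-(wordProb p r * (s + t)))) := by
  have e : ∀ ω, ENNReal.ofReal (occupiedCount π X j s ω * occupiedCount π X j t ω) =
      ∑' r, ∑' r', (hitSet π X j s r ∩ hitSet π X j t r').indicator (fun _ => 1) ω := by
    intro ω
    rw [ENNReal.ofReal_mul (show 0 ≤ occupiedCount π X j s ω from Nat.cast_nonneg _), ofReal_occupiedCount, ofReal_occupiedCount,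
      ← ENNReal.tsum_mul_right]
    refine tsum_congr fun r => ?_
    rw [← ENNReal.tsum_mul_left]
    refine tsum_congr fun r' => ?_
    rw [← Set.inter_indicator_mul (fun _ => (1 : ENNReal)) (fun _ => 1), one_mul]
  have m : ∀ r r', Measurable ((hitSet π X j s r ∩ hitSet π X j t r').indicator
      (fun _ => (1 : ENNReal))) := fun r r' =>
    measurable_const.indicator ((hX.measurableSet_hitSet s r).inter (hX.measurableSet_hitSet t r'))
  simp_rw [e]
  rw [lintegral_tsum fun r => (Measurable.tsum fun r' => m r r').aemeasurable]
  simp_rw [lintegral_tsum fun r' => (m _ r').aemeasurable,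
    lintegral_indicator_const ((hX.measurableSet_hitSet s _).inter (hX.measurableSet_hitSet t _)),
    one_mul, hX.measure_hitSet_inter hst, ENNReal.tsum_add, tsum_ite_eq', ENNReal.tsum_mul_left,
    ENNReal.tsum_mul_right, hX.lintegral_occupiedCount]

/-- Each term is at most the probability that the box is hit by time `s + t`, so the sum is at most
the mean count at that time. -/
theorem tsum_exp_sub_exp_lt_top (hX : IsPoissonizedNestedScheme p π X μ) (j : ℕ) (s t : ℝ≥0) :
    ∑' r : Fin j → ℕ, ENNReal.ofReal
      (Real.exp (-(wordProb p r * t)) - Real.exp (-(wordProb p r * (s + t)))) < ⊤ := by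
  refine lt_of_le_of_lt (ENNReal.tsum_le_tsum fun r => ENNReal.ofReal_le_ofReal ?_)
    ((hX.lintegral_occupiedCount j (s + t)).symm.trans_lt
      (hX.lintegral_occupiedCount_lt_top j (s + t)))
  rw [NNReal.coe_add]
  have : Real.exp (-(wordProb p r * t)) ≤ 1 :=
    Real.exp_le_one_iff.2 (neg_nonpos.2 (mul_nonneg (hX.wordProb_nonneg r) t.2))
  linarith

theorem memLp_occupiedCount (hX : IsPoissonizedNestedScheme p π X μ) (j : ℕ) (t : ℝ≥0) :
    MemLp (occupiedCount π X j t) 2 μ := by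
  have hm := hX.measurable_occupiedCount j t
  rw [memLp_two_iff_integrable_sq hm.aestronglyMeasurable]
  refine ⟨(hm.pow_const 2).aestronglyMeasurable, ?_⟩
  rw [hasFiniteIntegral_iff_ofReal (ae_of_all _ fun ω => sq_nonneg _)]
  simp_rw [pow_two]
  rw [hX.lintegral_occupiedCount_mul j le_rfl]
  exact ENNReal.add_lt_top.2 ⟨ENNReal.mul_lt_top (hX.lintegral_occupiedCount_lt_top j t)
    (hX.lintegral_occupiedCount_lt_top j t), hX.tsum_exp_sub_exp_lt_top j t t⟩

theorem covariance_occupiedCount (hX : IsPoissonizedNestedScheme p π X μ) (j : ℕ) {s t : ℝ≥0}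
    (hst : s ≤ t) :
    cov[occupiedCount π X j s, occupiedCount π X j t; μ] =
      (∑' r : Fin j → ℕ, ENNReal.ofReal
        (Real.exp (-(wordProb p r * t)) - Real.exp (-(wordProb p r * (s + t))))).toReal := by
  have h0 : ∀ (t : ℝ≥0) ω, 0 ≤ occupiedCount π X j t ω := fun t ω => Nat.cast_nonneg _
  have hm := hX.measurable_occupiedCount j
  have hI : ∀ t, ∫ ω, occupiedCount π X j t ω ∂μ =
      (∫⁻ ω, ENNReal.ofReal (occupiedCount π X j t ω) ∂μ).toReal := fun t =>
    integral_eq_lintegral_of_nonneg_ae (ae_of_all _ (h0 t)) (hm t).aestronglyMeasurable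
  rw [covariance_eq_sub (hX.memLp_occupiedCount j s) (hX.memLp_occupiedCount j t), hI, hI,
    integral_eq_lintegral_of_nonneg_ae (f := occupiedCount π X j s * occupiedCount π X j t)
      (ae_of_all _ fun ω => mul_nonneg (h0 s ω) (h0 t ω))
      ((hm s).mul (hm t)).aestronglyMeasurable]
  simp only [Pi.mul_apply]
  rw [hX.lintegral_occupiedCount_mul j hst, ENNReal.toReal_add
    (ENNReal.mul_lt_top (hX.lintegral_occupiedCount_lt_top j s)
      (hX.lintegral_occupiedCount_lt_top j t)).ne (hX.tsum_exp_sub_exp_lt_top j s t).ne,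
    ENNReal.toReal_mul, add_sub_cancel_left]

end IsPoissonizedNestedScheme

end Scheme

/-! ### Asymptotics of the covariances. -/

/-- The covariance of the numbers of occupied boxes at the times `e ^ x` and `e ^ y`, for `x ≤ y`,
as an integral against the point measure of the logarithms of the word probabilities. -/
theorem IsPoissonizedNestedScheme.covariance_expTime {Ω : Type*} [MeasurableSpace Ω]
    {μ : Measure Ω} [IsProbabilityMeasure μ] {p : ℕ → ℝ} {π : ℝ≥0 → Ω → ℕ} {X : ℕ → ℕ → Ω → ℕ}
    (hX : IsPoissonizedNestedScheme p π X μ) (j : ℕ) {x y : ℝ} (hxy : x ≤ y) :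
    cov[occupiedCount π X j (expTime x), occupiedCount π X j (expTime y); μ] =
      (∫⁻ z, ENNReal.ofReal (Real.exp (-Real.exp (y - z)) -
        Real.exp (-Real.exp (y + Real.log (1 + Real.exp (-(y - x))) - z)))
          ∂(wordLogMeasure p j)).toReal := by
  have hst : expTime x ≤ expTime y := Real.exp_le_exp.2 hxy
  have h := lintegral_wordLogMeasure hX.prob_nonneg j (φ := fun q => ENNReal.ofReal
    (Real.exp (-(q * expTime y)) - Real.exp (-(q * (expTime x + expTime y)))))
    (by fun_prop) (by simp)
  rw [hX.covariance_occupiedCount j hst]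
  unfold wordProb
  rw [← h]
  congr 1
  refine lintegral_congr fun z => ?_
  have e1 : (expTime x : ℝ) = Real.exp x := rfl
  have e2 : (expTime y : ℝ) = Real.exp y := rfl
  have e3 : Real.exp (y + Real.log (1 + Real.exp (-(y - x))) - z) =
      Real.exp (-z) * (Real.exp x + Real.exp y) := by
    rw [sub_eq_add_neg, Real.exp_add, Real.exp_add, Real.exp_log (by positivity), mul_add, mul_one,
      ← Real.exp_add y]
    ring_nf
  rw [e1, e2, e3, ← Real.exp_add (-z) y, neg_add_eq_sub]

theorem corollary4p5 {Ω : Type*} [MeasurableSpace Ω] (μ : Measure Ω) [IsProbabilityMeasure μ]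
    (p : ℕ → ℝ) (hp : IsInfiniteDistribution p)
    (π : ℝ≥0 → Ω → ℕ) (X : ℕ → ℕ → Ω → ℕ) (hX : IsPoissonizedNestedScheme p π X μ)
    (β : ℝ) (hβ : 0 ≤ β) (ℓ : ℝ → ℝ) (hℓ : IsSlowlyVarying ℓ)
    (hρ : ∀ a : ℝ, 0 < a →
      Tendsto (fun t : ℝ =>
          ((countingFunction p (a * t) : ℝ) - (countingFunction p t : ℝ)) /
            ((Real.log t) ^ β * ℓ (Real.log t)))
        atTop (𝓝 (Real.log a)))
    (hℓ₀ : β = 0 → EventuallyNondecreasingUnbounded ℓ)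
    (j : ℕ) (hj : 1 ≤ j) :
    (∀ t : ℝ≥0, MemLp (occupiedCount π X j t) 2 μ) ∧
    Asymptotics.IsEquivalent atTop
      (fun T : ℝ => Var[occupiedCount π X j (expTime T); μ])
      (fun T : ℝ => Real.log 2 * Real.Gamma (β + 1) ^ j / Real.Gamma (j * (β + 1)) *
        T ^ (j * β + j - 1) * ℓ T ^ j) ∧
    ∀ u v : ℝ,
      Tendsto (fun T : ℝ =>
          cov[occupiedCount π X j (expTime (T + u)), occupiedCount π X j (expTime (T + v)); μ] /
            Var[occupiedCount π X j (expTime T); μ])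
        atTop (𝓝 (Real.log (1 + Real.exp (-|u - v|)) / Real.log 2)) := by
  obtain ⟨L, hL, hLℓ⟩ := hℓ.exists_regularlyVarying
  have hg1 : wordDensity β L 1 =ᶠ[atTop] fun x => x ^ β * ℓ x := by
    filter_upwards [hLℓ, eventually_ge_atTop 1] with x hx hx1
    have hG := (Real.Gamma_pos_of_pos (by linarith : 0 < β + 1)).ne'
    rw [wordDensity, hx, max_eq_left hx1]
    simp [hG]
  have hrv1 := isRegularlyVarying_wordDensity hβ hL le_rfl
  -- The index for the first generation is `β`: positivity suffices when `β > 0`, while `β = 0`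
  -- needs the monotonicity of `ℓ`.
  have hq : IsQuasiMonotone (wordDensity β L 1) := by
    rcases hβ.eq_or_lt with h0 | h0
    · refine (hℓ₀ h0.symm).isQuasiMonotone hrv1 (hg1.trans ?_)
      filter_upwards with x
      rw [← h0, Real.rpow_zero, one_mul]
    · exact hrv1.isQuasiMonotone (by push_cast; linarith)
  have hloc := hasLocalDensity_wordLogMeasure hβ hL
    (hasLocalDensity_logMeasure hp (f := fun x => x ^ β * ℓ x) hρ hg1) hq hj
  have hrv := isRegularlyVarying_wordDensity hβ hL hj
  set G := wordDensity β L j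
  have hcov : ∀ x y : ℝ, x ≤ y → Tendsto (fun T => cov[occupiedCount π X j (expTime (T + x)),
      occupiedCount π X j (expTime (T + y)); μ] / G T) atTop
        (𝓝 (Real.log (1 + Real.exp (-(y - x))))) := by
    intro x y hxy
    have hd : 0 < Real.log (1 + Real.exp (-(y - x))) :=
      Real.log_pos (by linarith [Real.exp_pos (-(y - x))])
    have h1 := (hloc.tendsto_lintegral_exp_neg_exp hrv.measurable hrv.pos hd).comp
      (tendsto_atTop_add_const_right atTop y tendsto_id)
    -- The smoothing limit is taken at `T + y`; the shift invariance of `G` returns the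
    -- normalization to `G T`.
    have h2 := h1.mul (hloc.tendsto_shift_div hrv.pos y)
    rw [mul_one] at h2
    refine h2.congr fun T => ?_
    simp only [Function.comp, id]
    rw [hX.covariance_expTime j (by linarith : T + x ≤ T + y), add_sub_add_left_eq_sub,
      div_mul_div_cancel₀ (hrv.pos _).ne']
  have hvar : Tendsto (fun T => Var[occupiedCount π X j (expTime T); μ] / G T) atTop
      (𝓝 (Real.log 2)) := by
    have := hcov 0 0 le_rfl
    rw [sub_self, neg_zero, Real.exp_zero, one_add_one_eq_two] at this
    refine this.congr fun T => ?_
    rw [add_zero, covariance_self (hX.measurable_occupiedCount j _).aemeasurable]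
  have hl2 : 0 < Real.log 2 := Real.log_pos one_lt_two
  have hGeq : ∀ᶠ T in atTop, Real.log 2 * Real.Gamma (β + 1) ^ j / Real.Gamma (j * (β + 1)) *
      T ^ (j * β + j - 1) * ℓ T ^ j = Real.log 2 * G T := by
    filter_upwards [hLℓ, eventually_ge_atTop 1] with T hT hT1
    simp only [G, wordDensity]
    rw [hT, max_eq_left hT1]
    ring
  refine ⟨hX.memLp_occupiedCount j, ?_, fun u v => ?_⟩
  · rw [Asymptotics.isEquivalent_iff_tendsto_one]
    · have := hvar.div_const (Real.log 2)
      rw [div_self hl2.ne'] at this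
      refine this.congr' ?_
      filter_upwards [hGeq] with T hT
      rw [Pi.div_apply, hT, div_div, mul_comm (G T)]
    · filter_upwards [hGeq] with T hT
      rw [hT]
      exact (mul_pos hl2 (hrv.pos T)).ne'
  · have hnum : Tendsto (fun T => cov[occupiedCount π X j (expTime (T + u)),
        occupiedCount π X j (expTime (T + v)); μ] / G T) atTop
          (𝓝 (Real.log (1 + Real.exp (-|u - v|)))) := by
      rcases le_total u v with huv | huv
      · rw [abs_sub_comm, abs_of_nonneg (sub_nonneg.2 huv)]
        exact hcov u v huv
      · rw [abs_of_nonneg (sub_nonneg.2 huv)]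
        refine (hcov v u huv).congr fun T => ?_
        rw [covariance_comm]
    refine (hnum.div hvar hl2.ne').congr fun T => ?_
    exact div_div_div_cancel_right₀ (hrv.pos T).ne' _ _
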